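/- Let $d\ge 2$, let $\|\cdot\|$ be the Euclidean norm on $\mathbb R^d$, and write $\mathrm B_r^z=\{y:\|y-z\|\le r\}$, $\mathrm B_r=\mathrm B_r^0$, $\partial \mathrm B_r=\{y:\|y\|=r\}$. For a ($\sigma$-finite) measure $\nu$ on $(0,\infty)$ and $\lambda\ge 0$ let $\mathbb P_{\lambda,\nu}$ be the law of a Poisson point process $\eta$ on $\mathbb R^d\times(0,\infty)$ of intensity $\lambda\,dz\otimes\nu$, and let $\{A\longleftrightarrow B\}$ be the event that some point of $A$ is joined to some point of $B$ by a continuous path contained in $\bigcup_{(z,r)\in\eta}\mathrm B_r^z$ (if this event is not measurable, its probability is read as its outer probability). Let $\mu$ be a finite measure on $[1,\infty)$ with $\int t^d\,d\mu(t)<\infty$. For $\kappa>1$ let $$\mu_\kappa=\mu+\sum_{i\ge 1}\mathcal T_{\kappa^i}\big(\mu|_{[1,\kappa]}\big),\qquad \mathcal T_m\nu:=m^d\,(h_m)_*\nu,\quad h_m(x)=x/m ;$$ this is the radius measure of the multiscale process $\eta^{(0)}\cup\bigcup_{i\ge1}\kappa^{-i}\big(\eta^{(i)}\cap(\mathbb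 R^d\times[1,\kappa])\big)$, where the $\eta^{(i)}$, $i\ge 0$, are independent Poisson point processes of intensity $\lambda\,dz\otimes\mu$. Suppose that $\kappa_0>1$ is such that, for all $\kappa\ge\kappa_0$, $$\sup_{a\ge\kappa}\ \sup_{r\ge1}\ \frac{a^d\,\mu([ar,a\kappa])}{\mu([r,\kappa])}\le 1$$ (with $0/0=0$, and $x/0=\infty$ for $x>0$). Then for every $\kappa\ge\kappa_0$, every integer $j\ge1$, every real $l>1$ and every $\lambda\ge0$, $$\mathbb P_{\lambda,\,\mu_\kappa|_{(0,\kappa^j]}}\big(\mathrm B_{\kappa^j}\longleftrightarrow\partial \mathrm B_{l\kappa^j}\big)\ \le\ \mathbb P_{\lambda,\,\mu_\kappa|_{(0,1]}}\big(\mathrm B_1\longleftrightarrow\partial \mathrm B_l\big).$$ -/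

import Mathlib

open MeasureTheory ProbabilityTheory Set

open scoped ENNReal NNReal

noncomputable section

/-! ### Point configurations and Poisson point processes -/

/-- A point configuration in `X`: a subset of `X`. This is a copy of `Set X`, because the measurable
structure used on it is the one generated by the counting maps (and not by membership). -/
def Config (X : Type*) : Type _ := Set X

namespace Config

variable {X : Type*}

/-- The set of points of a configuration. -/
def points (S : Config X) : Set X := S

/-- The number, in `ℕ ∪ {∞}`, of points of the configuration `S` that lie in `B`. -/
def count (B : Set X) (S : Config X) : ℕ∞ := (S.points ∩ B).encard

/-- The σ-algebra on configurations generated by the maps `S ↦ #(S ∩ B)`, `B` measurable. -/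
instance [MeasurableSpace X] : MeasurableSpace (Config X) :=
  ⨆ (B : Set X) (_ : MeasurableSet B), MeasurableSpace.comap (count B) inferInstance

end Config

/-- The probability that a Poisson random variable of mean `m ∈ [0, ∞]` equals `n ∈ ℕ ∪ {∞}`; a
Poisson variable of infinite mean is equal to `∞` almost surely. -/
def poissonProb (m : ℝ≥0∞) (n : ℕ∞) : ℝ≥0∞ :=
  if m = ∞ then (if n = ⊤ then 1 else 0)
  else if n = ⊤ then 0 else poissonMeasure m.toNNReal {n.toNat}

/-- `P` is the law of a (simple) Poisson point process on `X` of intensity measure `Λ`: the number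
of points in a measurable set `B` is a Poisson variable of mean `Λ B`, and the numbers of points in
finitely many pairwise disjoint measurable sets are independent. -/
structure IsPoissonLaw {X : Type*} [MeasurableSpace X] (Λ : Measure X)
    (P : Measure (Config X)) : Prop where
  isProbabilityMeasure : IsProbabilityMeasure P
  count_law : ∀ B : Set X, MeasurableSet B → ∀ n : ℕ∞,
    P {S | S.count B = n} = poissonProb (Λ B) n
  indep : ∀ (k : ℕ) (B : Fin k → Set X), (∀ i, MeasurableSet (B i)) →
    Pairwise (fun i i' => Disjoint (B i) (B i')) →
    iIndepFun (fun i (S : Config X) => S.count (B i)) P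

/-! ### The Boolean model -/

/-- The Euclidean space `ℝ^d`. -/
abbrev Euc (d : ℕ) : Type := EuclideanSpace ℝ (Fin d)

/-- The occupied set: the union of the closed balls `B_r^z` over the points `(z, r)` of `S`. -/
def occupied {d : ℕ} (S : Config (Euc d × ℝ)) : Set (Euc d) :=
  ⋃ p ∈ S.points, Metric.closedBall p.1 p.2

/-- The event `{A ⟷ B}`: some point of `A` is joined to some point of `B` by a continuous path
inside the occupied set. -/
def connEvent {d : ℕ} (A B : Set (Euc d)) : Set (Config (Euc d × ℝ)) :=
  {S | ∃ x ∈ A, ∃ y ∈ B, JoinedIn (occupied S) x y}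

/-- `P` is the law `ℙ_{lam, ν}` of the Boolean model: a Poisson point process on `ℝ^d × ℝ` of
intensity `lam dz ⊗ ν`, where `ν` is the radius measure. -/
def IsBooleanLaw (d : ℕ) (lam : ℝ≥0) (ν : Measure ℝ)
    (P : Measure (Config (Euc d × ℝ))) : Prop :=
  IsPoissonLaw (lam • (volume : Measure (Euc d)).prod ν) P

/-! ### The multiscale model -/

/-- `𝒯_m ν = m^d (h_m)_* ν`, where `h_m x = x / m`. -/
def rescaleRadius (d : ℕ) (m : ℝ) (ν : Measure ℝ) : Measure ℝ :=
  ENNReal.ofReal (m ^ d) • ν.map (fun x => x / m)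

/-- The radius measure `μ_κ = μ + ∑_{i ≥ 1} 𝒯_{κ^i} (μ|_{[1, κ]})` of the multiscale model. -/
def multiscaleRadius (d : ℕ) (μ : Measure ℝ) (κ : ℝ) : Measure ℝ :=
  μ + Measure.sum (fun i : ℕ => rescaleRadius d (κ ^ (i + 1)) (μ.restrict (Icc 1 κ)))

/-- The intensity measure of the multiscale process
`η_κ(lam) = η^(0) ∪ ⋃_{i ≥ 1} κ^{-i} (η^(i) ∩ (ℝ^d × [1, κ]))`, where the `η^(i)` are independent
Poisson point processes of intensity `lam dz ⊗ μ`. -/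
def multiscaleIntensity (d : ℕ) (lam : ℝ≥0) (μ : Measure ℝ) (κ : ℝ) : Measure (Euc d × ℝ) :=
  lam • (volume : Measure (Euc d)).prod μ +
    Measure.sum (fun i : ℕ =>
      ((lam • (volume : Measure (Euc d)).prod μ).restrict (univ ×ˢ Icc 1 κ)).map
        (fun p => (κ ^ (i + 1))⁻¹ • p))

/-- The multiscale process has intensity `lam dz ⊗ μ_κ`. -/
theorem multiscaleIntensity_eq (d : ℕ) (lam : ℝ≥0) (μ : Measure ℝ) [IsFiniteMeasure μ]
    (κ : ℝ) (hκ : 0 < κ) :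
    multiscaleIntensity d lam μ κ
      = lam • (volume : Measure (Euc d)).prod (multiscaleRadius d μ κ) := by
  have hs : ∀ i : ℕ, SFinite (rescaleRadius d (κ ^ (i + 1)) (μ.restrict (Icc 1 κ))) := by
    intro i; unfold rescaleRadius; infer_instance
  unfold multiscaleIntensity multiscaleRadius
  rw [Measure.prod_add, Measure.prod_sum_right, smul_add]
  congr 1
  suffices h : ∀ i : ℕ, ((lam • (volume : Measure (Euc d)).prod μ).restrict
      (univ ×ˢ Icc 1 κ)).map (fun p => (κ ^ (i + 1))⁻¹ • p)
      = lam • (volume : Measure (Euc d)).prod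
        (rescaleRadius d (κ ^ (i + 1)) (μ.restrict (Icc 1 κ))) by
    ext s hs'
    simp only [h, Measure.sum_apply _ hs', Measure.smul_apply]
    simp only [ENNReal.smul_def, smul_eq_mul, ENNReal.tsum_mul_left]
  intro i
  have hm : 0 < κ ^ (i + 1) := by positivity
  have hfun : (fun p : Euc d × ℝ => (κ ^ (i + 1))⁻¹ • p)
      = Prod.map (fun z => (κ ^ (i + 1))⁻¹ • z) (fun x => x / κ ^ (i + 1)) := by
    funext p
    ext1
    · rfl
    · simp [div_eq_inv_mul]
  rw [Measure.restrict_smul, Measure.map_smul, ← Measure.prod_restrict, Measure.restrict_univ,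
    hfun, ← Measure.map_prod_map _ _ (by fun_prop) (by fun_prop),
    Measure.map_addHaar_smul _ (inv_ne_zero hm.ne')]
  unfold rescaleRadius
  rw [Measure.prod_smul_left, Measure.prod_smul_right]
  congr 3
  simp [abs_of_pos hm]

/-- The regularity assumption on the radius distribution `μ`, with threshold `κ₀`: for all
`κ ≥ κ₀`, `sup_{a ≥ κ} sup_{r ≥ 1} a^d μ([a r, a κ]) / μ([r, κ]) ≤ 1`. The quotient is taken in
`[0, ∞]`, where `0 / 0 = 0` and `x / 0 = ∞` for `x > 0`. -/
def ScalingHyp (d : ℕ) (μ : Measure ℝ) (κ₀ : ℝ) : Prop :=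
  ∀ κ : ℝ, κ₀ ≤ κ →
    ⨆ (a : ℝ) (_ : κ ≤ a) (r : ℝ) (_ : 1 ≤ r),
      ENNReal.ofReal (a ^ d) * μ (Icc (a * r) (a * κ)) / μ (Icc r κ) ≤ 1

end

/-! Shrinking space by `κ ^ j` turns a Boolean model of radius measure `ν` into one of radius
measure `𝒯_{κ^j} ν`. It is therefore enough to match the radii of `𝒯_{κ^j} (μ_κ|_{(0,κ^j]})` with
larger radii of `μ_κ|_{(0,1]}`, since enlarging balls preserves connections.

Under `𝒯_{κ^j}` the scale `i ≥ 1` of `μ_κ` becomes the scale `i + j`, so the scales beyond `j` agree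
exactly. What remains is `μ|_{[1,κ^j]}`, to be placed below the scales `1, ..., j`. Cut it into `[1,
κ]` and the shells `(κ^i, κ^{i+1}]`, `1 ≤ i < j`. The first piece becomes the scale `j` itself. For
a shell, `ScalingHyp` with `a = κ^i` says that its image under `𝒯_{κ^i}` has smaller tails than
`μ|_{[1,κ]}`; applying the remaining `𝒯_{κ^{j-i}}` places it below the scale `j - i`. This is
`radiusDominated_multiscaleRadius`.

Tail comparison yields a coupling of the radii by quantile functions (`RadiusDominated.of_tail_le`).
A Poisson process of centres marked by the coupled pairs then carries both models, each ball of the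
rescaled first one lying in a concentric ball of the second (`RadiusDominated.connEvent_le`).

Since the two laws are known only through their counts, this needs an explicit Poisson sample
(`PoissonSample.exists_config`) and uniqueness of the Poisson law (`HasPoissonCounts.unique`). Since
connection events need not be measurable, the coupling inequality is proved for outer probabilities
(`IsPoissonLaw.map_le_of_preimage_subset`). -/

noncomputable section

open Filter Topology

/-! ### Poisson laws on `ℕ∞` and their generating functions -/

/-- `exp (-c)` for `c ∈ [0, ∞]`, with `exp (-∞) = 0`. -/
def expNeg (c : ℝ≥0∞) : ℝ≥0∞ := (EReal.exp (c : EReal))⁻¹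

lemma one_le_exp_coe (c : ℝ≥0∞) : 1 ≤ EReal.exp (c : EReal) :=
  EReal.one_le_exp_iff.2 (EReal.coe_ennreal_nonneg c)

lemma expNeg_zero : expNeg 0 = 1 := by simp [expNeg]

lemma expNeg_top : expNeg ∞ = 0 := by simp [expNeg]

lemma expNeg_add (a b : ℝ≥0∞) : expNeg (a + b) = expNeg a * expNeg b := by
  unfold expNeg
  rw [EReal.coe_ennreal_add, EReal.exp_add, ENNReal.mul_inv]
  · exact Or.inl (zero_lt_one.trans_le (one_le_exp_coe a)).ne'
  · exact Or.inr (zero_lt_one.trans_le (one_le_exp_coe b)).ne'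

lemma expNeg_sum {ι : Type*} (s : Finset ι) (c : ι → ℝ≥0∞) :
    expNeg (∑ i ∈ s, c i) = ∏ i ∈ s, expNeg (c i) := by
  classical
  induction s using Finset.induction_on with
  | empty => simp [expNeg_zero]
  | insert a s ha ih => rw [Finset.sum_insert ha, Finset.prod_insert ha, expNeg_add, ih]

lemma continuous_expNeg : Continuous expNeg :=
  continuous_inv.comp (ENNReal.continuous_exp.comp continuous_coe_ennreal_ereal)

lemma expNeg_coe (r : ℝ≥0) : expNeg r = ENNReal.ofReal (Real.exp (-r)) := by
  unfold expNeg
  rw [show ((r : ℝ≥0∞) : EReal) = ((r : ℝ) : EReal) from rfl, EReal.exp_coe, Real.exp_neg,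
    ENNReal.ofReal_inv_of_pos (Real.exp_pos _)]

lemma lintegral_pow_poissonMeasure (M : ℝ≥0) {x : ℝ≥0∞} (hx : x ≤ 1) :
    ∫⁻ k, x ^ k ∂(poissonMeasure M) = expNeg (M * (1 - x)) := by
  lift x to ℝ≥0 using (hx.trans_lt ENNReal.one_lt_top).ne
  have hx1 : x ≤ 1 := by exact_mod_cast hx
  have hs : HasSum (fun k : ℕ => Real.exp (-M) * ((M * x : ℝ) ^ k / (k.factorial : ℝ)))
      (Real.exp (-M) * Real.exp (M * x)) := by
    refine HasSum.mul_left _ ?_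
    have := NormedSpace.expSeries_div_hasSum_exp (𝔸 := ℝ) (M * x : ℝ)
    rwa [← Real.exp_eq_exp_ℝ] at this
  have key : ∀ k : ℕ, (x : ℝ≥0∞) ^ k * poissonMeasure M {k}
      = ENNReal.ofReal (Real.exp (-M) * ((M * x : ℝ) ^ k / (k.factorial : ℝ))) := by
    intro k
    rw [poissonMeasure_singleton, ← ENNReal.ofReal_coe_nnreal, ← ENNReal.ofReal_pow (by positivity),
      ← ENNReal.ofReal_mul (by positivity)]
    congr 1
    ring
  rw [lintegral_countable']
  simp_rw [key]
  rw [← ENNReal.ofReal_tsum_of_nonneg (fun k => by positivity) hs.summable, hs.tsum_eq,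
    ← Real.exp_add]
  have : (M : ℝ≥0∞) * (1 - x) = ((M * (1 - x) : ℝ≥0) : ℝ≥0∞) := by
    push_cast; rfl
  rw [this, expNeg_coe]
  congr 2
  rw [NNReal.coe_mul, NNReal.coe_sub hx1]
  push_cast
  ring

/-- The Poisson law on `ℕ ∪ {∞}` of mean `c ∈ [0, ∞]`. -/
def poissonENat (c : ℝ≥0∞) : Measure ℕ∞ :=
  if c = ∞ then Measure.dirac ⊤ else (poissonMeasure c.toNNReal).map (fun n : ℕ => (n : ℕ∞))

instance (c : ℝ≥0∞) : IsProbabilityMeasure (poissonENat c) := by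
  unfold poissonENat
  split_ifs
  · infer_instance
  · exact Measure.isProbabilityMeasure_map (measurable_of_countable _).aemeasurable

lemma poissonENat_singleton (c : ℝ≥0∞) (n : ℕ∞) : poissonENat c {n} = poissonProb c n := by
  unfold poissonENat poissonProb
  split_ifs with h1 h2 h2
  · simp [h2]
  · rw [Measure.dirac_apply' _ (measurableSet_singleton n)]
    simp [Ne.symm h2]
  · rw [Measure.map_apply (measurable_of_countable _) (measurableSet_singleton n)]
    have : (fun n : ℕ => (n : ℕ∞)) ⁻¹' {n} = ∅ := by
      ext k; simp [h2]
    rw [this, measure_empty]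
  · rw [Measure.map_apply (measurable_of_countable _) (measurableSet_singleton n)]
    congr 1
    ext k
    lift n to ℕ using h2
    simp

/-- The weight `2^{-n}` of `n ∈ ℕ ∪ {∞}`. -/
def halfPow : ℕ∞ → ℝ≥0∞ := fun n => if n = ⊤ then 0 else 2⁻¹ ^ n.toNat

@[simp] lemma halfPow_top : halfPow ⊤ = 0 := by simp [halfPow]

@[simp] lemma halfPow_coe (n : ℕ) : halfPow n = 2⁻¹ ^ n := by simp [halfPow]

lemma halfPow_antitone : Antitone halfPow := by
  intro a b hab
  induction b using ENat.recTopCoe with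
  | top => simp
  | coe b =>
    lift a to ℕ using (hab.trans_lt (ENat.natCast_lt_top b)).ne
    rw [halfPow_coe, halfPow_coe]
    exact pow_le_pow_right_of_le_one' (by simp) (by exact_mod_cast hab)

lemma halfPow_le_one (n : ℕ∞) : halfPow n ≤ 1 := by
  have h := halfPow_antitone (zero_le (a := n))
  rwa [← Nat.cast_zero, halfPow_coe, pow_zero] at h

lemma halfPow_injective : Function.Injective halfPow := by
  have h : ∀ a b : ℕ∞, a < b → halfPow b < halfPow a := by
    intro a b hab
    lift a to ℕ using hab.ne_top
    induction b using ENat.recTopCoe with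
    | top => simpa using ENNReal.pow_pos (by simp) a
    | coe b =>
      rw [halfPow_coe, halfPow_coe]
      have hab' : a < b := by exact_mod_cast hab
      rw [← ENNReal.inv_pow, ← ENNReal.inv_pow, ENNReal.inv_lt_inv]
      exact_mod_cast Nat.pow_lt_pow_right one_lt_two hab'
  intro a b hab
  rcases lt_trichotomy a b with h1 | h1 | h1
  · exact absurd hab (h _ _ h1).ne'
  · exact h1
  · exact absurd hab (h _ _ h1).ne

/-- The generating function at `2^{-m}` is also the `m`-th moment of the bounded variable `2^{-N}`,
so these points alone determine a law, infinite counts included. -/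
lemma lintegral_halfPow_poissonENat (c : ℝ≥0∞) (m : ℕ) :
    ∫⁻ n, halfPow n ^ m ∂(poissonENat c) = expNeg (c * (1 - 2⁻¹ ^ m)) := by
  unfold poissonENat
  split_ifs with h
  · rw [lintegral_dirac, h, halfPow_top]
    -- For `m = 0` both conventions `0 ^ 0 = 1` and `∞ * 0 = 0` are used, and both sides equal `1`.
    rcases Nat.eq_zero_or_pos m with rfl | hm
    · simp [expNeg_zero]
    · have : (2⁻¹ : ℝ≥0∞) ^ m < 1 := pow_lt_one₀ (by simp) (by simp) hm.ne'
      rw [ENNReal.top_mul (tsub_pos_of_lt this).ne', expNeg_top, zero_pow hm.ne']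
  · rw [lintegral_map (measurable_of_countable _) (measurable_of_countable _)]
    simp only [halfPow_coe]
    have : ∀ k : ℕ, ((2⁻¹ : ℝ≥0∞) ^ k) ^ m = (2⁻¹ ^ m) ^ k := fun k => by
      rw [← pow_mul, ← pow_mul, mul_comm]
    simp_rw [this]
    rw [lintegral_pow_poissonMeasure _ (pow_le_one₀ (by simp) (by simp)), ENNReal.coe_toNNReal h]

/-- Finite measures on `[0, 1]^ι` with the same mixed moments are equal. -/
lemma unitInterval_pi_ext {ι : Type*} [Fintype ι] (μ ν : Measure (ι → Icc (0 : ℝ) 1))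
    [IsFiniteMeasure μ] [IsFiniteMeasure ν]
    (h : ∀ m : ι → ℕ, ∫ x, ∏ i, (x i : ℝ) ^ m i ∂μ = ∫ x, ∏ i, (x i : ℝ) ^ m i ∂ν) : μ = ν := by
  classical
  let X : ι → BoundedContinuousFunction (ι → Icc (0 : ℝ) 1) ℝ := fun i =>
    BoundedContinuousFunction.mkOfCompact ⟨fun x => (x i : ℝ), by fun_prop⟩
  -- The algebra of polynomials in the coordinates separates points, so integrals over it determine
  -- a finite measure; by linearity monomials suffice.
  let A : StarSubalgebra ℝ (BoundedContinuousFunction (ι → Icc (0 : ℝ) 1) ℝ) :=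
    { (MvPolynomial.aeval (R := ℝ) X).range with
      star_mem' := fun {a} ha => by
        have : star a = a := by ext; simp
        rwa [this] }
  have hXA : ∀ i, X i ∈ A := fun i => ⟨MvPolynomial.X i, by simp⟩
  refine ext_of_forall_mem_subalgebra_integral_eq_of_pseudoEMetric_complete_countable
    (A := A) (𝕜 := ℝ) ?_ ?_
  · intro x y hxy
    obtain ⟨i, hi⟩ : ∃ i, x i ≠ y i := by
      by_contra! hc
      exact hxy (funext hc)
    refine ⟨X i, ⟨BoundedContinuousFunction.toContinuousMapStarₐ ℝ (X i), ⟨X i, hXA i, rfl⟩, rfl⟩, ?_⟩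
    intro he
    exact hi (Subtype.ext he)
  · rintro g ⟨p, rfl⟩
    have hint : ∀ ρ : Measure (ι → Icc (0 : ℝ) 1), IsFiniteMeasure ρ →
        ∫ x, (MvPolynomial.aeval X p) x ∂ρ
          = ∑ d ∈ p.support, p.coeff d * ∫ x, ∏ i, (x i : ℝ) ^ d i ∂ρ := by
      intro ρ _
      have hx : ∀ x, (MvPolynomial.aeval X p) x
          = ∑ d ∈ p.support, p.coeff d * ∏ i, (x i : ℝ) ^ d i := by
        intro x
        rw [MvPolynomial.aeval_def, MvPolynomial.eval₂_eq']
        simp [BoundedContinuousFunction.sum_apply, X, Algebra.algebraMap_eq_smul_one]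
      simp_rw [hx]
      rw [integral_finsetSum]
      · simp_rw [integral_const_mul]
      · intro d _
        refine Integrable.const_mul ?_ _
        refine Integrable.of_bound (C := 1) ?_ ?_
        · exact (by fun_prop : Continuous _).aestronglyMeasurable
        · refine ae_of_all _ fun x => ?_
          rw [Real.norm_eq_abs, Finset.abs_prod]
          refine Finset.prod_le_one (fun _ _ => abs_nonneg _) fun i _ => ?_
          rw [abs_of_nonneg (pow_nonneg (x i).2.1 _)]
          exact pow_le_one₀ (x i).2.1 (x i).2.2
    change ∫ x, (MvPolynomial.aeval X p) x ∂μ = ∫ x, (MvPolynomial.aeval X p) x ∂ν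
    rw [hint μ inferInstance, hint ν inferInstance]
    exact Finset.sum_congr rfl fun d _ => by rw [h]

/-- Finite measures on `ℕ∞^ι` with the same generating function at the points of `{2^{-m}}^ι` are
equal. -/
lemma enat_pi_ext {ι : Type*} [Fintype ι] (μ ν : Measure (ι → ℕ∞))
    [IsFiniteMeasure μ] [IsFiniteMeasure ν]
    (h : ∀ m : ι → ℕ, ∫⁻ x, ∏ i, halfPow (x i) ^ m i ∂μ = ∫⁻ x, ∏ i, halfPow (x i) ^ m i ∂ν) :
    μ = ν := by
  have hfin : ∀ n, halfPow n ≠ ∞ := fun n => ((halfPow_le_one n).trans_lt ENNReal.one_lt_top).ne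
  -- The injection `n ↦ 2^{-n}` of `ℕ∞` into `[0, 1]` turns the values of the generating function
  -- into mixed moments.
  let v : ℕ∞ → Icc (0 : ℝ) 1 := fun n => ⟨(halfPow n).toReal, ENNReal.toReal_nonneg, by
    simpa using ENNReal.toReal_mono ENNReal.one_ne_top (halfPow_le_one n)⟩
  have hv : Function.Injective v := by
    intro a b hab
    exact halfPow_injective ((ENNReal.toReal_eq_toReal_iff' (hfin a) (hfin b)).1
      (show (v a : ℝ) = v b by rw [hab]))
  let V : (ι → ℕ∞) → (ι → Icc (0 : ℝ) 1) := fun x i => v (x i)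
  have hV : Function.Injective V := fun x y hxy => funext fun i => hv (congrFun hxy i)
  have hVm : Measurable V := measurable_of_countable _
  have hmom : ∀ (ρ : Measure (ι → ℕ∞)) (m : ι → ℕ),
      ∫ x, ∏ i, (x i : ℝ) ^ m i ∂(ρ.map V) = (∫⁻ x, ∏ i, halfPow (x i) ^ m i ∂ρ).toReal := by
    intro ρ m
    rw [integral_map hVm.aemeasurable (by
      exact (by fun_prop : Continuous _).aestronglyMeasurable),
      ← integral_toReal (measurable_of_countable _).aemeasurable]
    · refine integral_congr_ae (ae_of_all _ fun x => ?_)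
      simp [V, v, ENNReal.toReal_prod]
    · refine ae_of_all _ fun x => ENNReal.prod_lt_top fun i _ => ?_
      exact ENNReal.pow_lt_top (hfin _).lt_top
  have hmap : μ.map V = ν.map V := by
    have := Measure.isFiniteMeasure_map μ V
    have := Measure.isFiniteMeasure_map ν V
    refine unitInterval_pi_ext _ _ fun m => ?_
    rw [hmom, hmom, h]
  refine Measure.ext_iff_singleton.2 fun a => ?_
  have := congrArg (fun ρ => ρ {V a}) hmap
  simp only [Measure.map_apply hVm (measurableSet_singleton _)] at this
  rwa [show V ⁻¹' {V a} = {a} by ext b; simp [hV.eq_iff]] at this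

/-! ### A Poisson law is determined by its intensity -/

namespace Config

variable {X : Type*}

lemma measurable_count [MeasurableSpace X] {B : Set X} (hB : MeasurableSet B) :
    Measurable (count B) := by
  refine Measurable.mono (comap_measurable (count B)) ?_ le_rfl
  exact le_iSup₂ (f := fun (B : Set X) (_ : MeasurableSet B) =>
    MeasurableSpace.comap (count B) inferInstance) B hB

lemma measurable_of_measurable_count [MeasurableSpace X] {Ω : Type*} [MeasurableSpace Ω]
    {F : Ω → Config X} (h : ∀ B, MeasurableSet B → Measurable fun ω => (F ω).count B) :
    Measurable F := by
  rw [measurable_iff_comap_le]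
  simp only [instMeasurableSpace, MeasurableSpace.comap_iSup, MeasurableSpace.comap_comp]
  exact iSup₂_le fun B hB => (h B hB).comap_le

/-- The counts of the cells of the partition generated by a finite family determine the counts of
the members of the family. -/
lemma count_eq_sum_cells {ι : Type*} [Finite ι] (B : ι → Set X) (S : Config X) (i : ι) :
    S.count (B i) = ∑ᶠ t : {t : Set ι // i ∈ t}, S.count {x | {i | x ∈ B i} = t.1} := by
  classical
  have h : S.points ∩ B i = ⋃ t : {t : Set ι // i ∈ t}, S.points ∩ {x | {i | x ∈ B i} = t.1} := by
    ext x
    simp only [mem_inter_iff, mem_iUnion, mem_ofPred_eq, Subtype.exists]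
    constructor
    · rintro ⟨hx, hi⟩
      exact ⟨_, hi, hx, rfl⟩
    · rintro ⟨t, ht, hx, rfl⟩
      exact ⟨hx, ht⟩
  unfold count
  rw [h, encard_iUnion_of_finite]
  intro s t hst
  refine Set.disjoint_left.2 ?_
  rintro x ⟨-, hs⟩ ⟨-, ht⟩
  exact hst (Subtype.ext (hs.symm.trans ht))

end Config

/-- The numbers of points in finitely many disjoint measurable sets are independent Poisson
variables of means given by `Λ`. -/
def HasPoissonCounts {X : Type*} [MeasurableSpace X] (Λ : Measure X)
    (P : Measure (Config X)) : Prop :=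
  ∀ (k : ℕ) (B : Fin k → Set X), (∀ i, MeasurableSet (B i)) →
    Pairwise (fun i i' => Disjoint (B i) (B i')) →
    P.map (fun S i => S.count (B i)) = Measure.pi (fun i => poissonENat (Λ (B i)))

section

variable {X : Type*} [MeasurableSpace X] {Λ : Measure X} {P P' : Measure (Config X)}

lemma IsPoissonLaw.hasPoissonCounts (h : IsPoissonLaw Λ P) : HasPoissonCounts Λ P := by
  have := h.isProbabilityMeasure
  intro k B hB hd
  rw [(iIndepFun_iff_map_fun_eq_pi_map fun i =>
    (Config.measurable_count (hB i)).aemeasurable).1 (h.indep k B hB hd)]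
  congr 1
  funext i
  refine Measure.ext_iff_singleton.2 fun n => ?_
  rw [Measure.map_apply (Config.measurable_count (hB i)) (measurableSet_singleton n),
    poissonENat_singleton, ← h.count_law _ (hB i)]
  rfl

/-- The sets may overlap, so their counts are written as sums over the disjoint cells of the
partition they generate, whose joint law is prescribed. -/
lemma HasPoissonCounts.map_count_eq (h : HasPoissonCounts Λ P) (h' : HasPoissonCounts Λ P')
    {ι : Type*} [Finite ι] (B : ι → Set X) (hB : ∀ i, MeasurableSet (B i)) :
    P.map (fun S i => S.count (B i)) = P'.map (fun S i => S.count (B i)) := by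
  classical
  have := Fintype.ofFinite ι
  let e := Fintype.equivFin (Set ι)
  let C : Fin (Fintype.card (Set ι)) → Set X := fun a => {x | {i | x ∈ B i} = e.symm a}
  have hC : ∀ a, MeasurableSet (C a) := by
    intro a
    have : C a = ⋂ i, {x | x ∈ B i ↔ i ∈ e.symm a} := by
      ext x
      simp [C, Set.ext_iff]
    rw [this]
    refine MeasurableSet.iInter fun i => ?_
    by_cases hi : i ∈ e.symm a
    · simpa [hi] using hB i
    · simp only [hi, iff_false]
      exact (hB i).compl
  have hd : Pairwise (fun a b => Disjoint (C a) (C b)) := by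
    intro a b hab
    refine Set.disjoint_left.2 fun x hx hx' => hab (e.symm.injective ?_)
    exact Eq.trans (Eq.symm hx) hx'
  have hm : Measurable (fun (S : Config X) a => S.count (C a)) :=
    measurable_pi_lambda _ fun a => Config.measurable_count (hC a)
  let g : (Fin (Fintype.card (Set ι)) → ℕ∞) → ι → ℕ∞ := fun n i =>
    ∑ᶠ t : {t : Set ι // i ∈ t}, n (e t)
  have hg : (fun (S : Config X) i => S.count (B i)) = g ∘ fun S a => S.count (C a) := by
    funext S i
    rw [Config.count_eq_sum_cells B S i]
    simp [g, C]
  rw [hg, ← Measure.map_map (measurable_of_countable _) hm,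
    ← Measure.map_map (measurable_of_countable _) hm, h _ C hC hd, h' _ C hC hd]

/-- The σ-algebra on configurations is pulled back from the product of all counts, and a law on the
product is determined by its finite-dimensional marginals. -/
lemma HasPoissonCounts.unique [IsProbabilityMeasure P] [IsProbabilityMeasure P']
    (h : HasPoissonCounts Λ P) (h' : HasPoissonCounts Λ P') : P = P' := by
  let J := {B : Set X // MeasurableSet B}
  let c : Config X → J → ℕ∞ := fun S B => S.count B.1
  have hc : Measurable c := measurable_pi_lambda _ fun B => Config.measurable_count B.2
  have hcomap : (Config.instMeasurableSpace : MeasurableSpace (Config X))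
      = MeasurableSpace.comap c inferInstance := by
    simp only [Config.instMeasurableSpace, MeasurableSpace.pi, MeasurableSpace.comap_iSup,
      MeasurableSpace.comap_comp, iSup_subtype']
    rfl
  have hmap : P.map c = P'.map c := by
    have := Measure.isProbabilityMeasure_map (μ := P) hc.aemeasurable
    have := Measure.isProbabilityMeasure_map (μ := P') hc.aemeasurable
    refine IsProjectiveLimit.unique (P := fun I : Finset J => (P.map c).map I.restrict)
      (fun I => rfl) fun I => ?_
    change (P'.map c).map I.restrict = (P.map c).map I.restrict
    rw [Measure.map_map (Finset.measurable_restrict I) hc,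
      Measure.map_map (Finset.measurable_restrict I) hc]
    exact h'.map_count_eq h (fun B : I => B.1.1) fun B => B.1.2
  ext E hE
  rw [hcomap] at hE
  obtain ⟨E', hE', rfl⟩ := hE
  rw [← Measure.map_apply hc hE', ← Measure.map_apply hc hE', hmap]

end

/-! ### Locally finite configurations and outer probabilities -/

/-- A point of `S` in `K n` missing from `T` has a basic neighbourhood avoiding the finite, hence
closed, set `T ∩ K n`, and the counts there differ. Thus countably many counts separate locally
finite configurations. -/
lemma Config.eq_of_count_eq {X : Type*} [TopologicalSpace X] [T1Space X]
    [SecondCountableTopology X] {K : ℕ → Set X} {S T : Config X}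
    (hS : S.points ⊆ ⋃ n, K n) (hT : T.points ⊆ ⋃ n, K n)
    (hSf : ∀ n, S.count (K n) < ⊤) (hTf : ∀ n, T.count (K n) < ⊤)
    (h : ∀ U ∈ TopologicalSpace.countableBasis X, ∀ n, S.count (U ∩ K n) = T.count (U ∩ K n)) :
    S = T := by
  have key : ∀ {S T : Config X}, S.points ⊆ ⋃ n, K n → (∀ n, T.count (K n) < ⊤) →
      (∀ U ∈ TopologicalSpace.countableBasis X, ∀ n, S.count (U ∩ K n) = T.count (U ∩ K n)) →
      S.points ⊆ T.points := by
    intro S T hS hTf h x hx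
    by_contra hxT
    obtain ⟨n, hn⟩ := mem_iUnion.1 (hS hx)
    have hfin : (T.points ∩ K n).Finite := encard_lt_top_iff.1 (hTf n)
    obtain ⟨U, hU, hxU, hUT⟩ := (TopologicalSpace.isBasis_countableBasis X).exists_subset_of_mem_open
      (show x ∈ (T.points ∩ K n)ᶜ from fun hx' => hxT hx'.1) hfin.isClosed.isOpen_compl
    have h0 : T.count (U ∩ K n) = 0 := by
      unfold Config.count
      rw [encard_eq_zero, Set.eq_empty_iff_forall_notMem]
      rintro y ⟨hyT, hyU, hyK⟩
      exact hUT hyU ⟨hyT, hyK⟩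
    rw [← h U hU n] at h0
    unfold Config.count at h0
    rw [encard_eq_zero] at h0
    exact (h0.subset ⟨hx, hxU, hn⟩ : x ∈ (∅ : Set X))
  exact Subset.antisymm (key hS hTf h) (key hT hSf fun U hU n => (h U hU n).symm)

lemma IsPoissonLaw.ae_locallyFinite {X : Type*} [MeasurableSpace X] {Λ : Measure X}
    {P : Measure (Config X)} (h : IsPoissonLaw Λ P) {K : ℕ → Set X}
    (hK : ∀ n, MeasurableSet (K n)) (hfin : ∀ n, Λ (K n) < ∞) (hcov : Λ (⋃ n, K n)ᶜ = 0) :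
    ∀ᵐ S ∂P, S.points ⊆ ⋃ n, K n ∧ ∀ n, S.count (K n) < ⊤ := by
  have := h.isProbabilityMeasure
  have h1 : ∀ᵐ S ∂P, S.count (⋃ n, K n)ᶜ = 0 := by
    have hm := (MeasurableSet.iUnion hK).compl
    have hP := h.count_law _ hm 0
    rw [hcov] at hP
    have h1' : P {S | S.count (⋃ n, K n)ᶜ = 0} = 1 := by
      rw [hP]
      simp [poissonProb, poissonMeasure_singleton]
    exact (prob_compl_eq_zero_iff
      (Config.measurable_count hm (measurableSet_singleton 0))).2 h1'
  have h2 : ∀ n, ∀ᵐ S ∂P, S.count (K n) < ⊤ := by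
    intro n
    have hP := h.count_law _ (hK n) ⊤
    simp only [poissonProb, (hfin n).ne, if_false, if_true] at hP
    rw [ae_iff]
    convert hP using 3
    simp
  filter_upwards [h1, ae_all_iff.2 h2] with S hS hS'
  refine ⟨?_, hS'⟩
  unfold Config.count at hS
  rw [encard_eq_zero] at hS
  intro x hx
  by_contra hx'
  exact (hS.subset ⟨hx, hx'⟩ : x ∈ (∅ : Set X))

/-- If the law of `F` is Poisson and the event `F ∈ A` is contained, up to null sets, in a
measurable set `E`, then the outer probability of `A` is at most the probability of `E`. -/
lemma IsPoissonLaw.map_le_of_preimage_subset {X : Type*} [MeasurableSpace X]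
    [TopologicalSpace X] [OpensMeasurableSpace X] [T1Space X] [SecondCountableTopology X]
    {Λ : Measure X} [SigmaFinite Λ]
    {Ω : Type*} [MeasurableSpace Ω] [StandardBorelSpace Ω] [Nonempty Ω]
    {ρ : Measure Ω} [IsProbabilityMeasure ρ]
    {F : Ω → Config X} (hF : Measurable F) (h : IsPoissonLaw Λ (ρ.map F))
    {A : Set (Config X)} {E : Set Ω} (hE : MeasurableSet E) (hAE : ∀ᵐ ω ∂ρ, F ω ∈ A → ω ∈ E) :
    ρ.map F A ≤ ρ E := by
  let K := spanningSets Λ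
  have hKm := measurableSet_spanningSets Λ
  have hgood := h.ae_locallyFinite hKm (measure_spanningSets_lt_top Λ)
    (by simp [iUnion_spanningSets])
  let J := TopologicalSpace.countableBasis X × ℕ
  have : Countable J := inferInstance
  let c : Config X → J → ℕ∞ := fun S p => S.count (p.1.1 ∩ K p.2)
  have hc : Measurable c := measurable_pi_lambda _ fun p => Config.measurable_count
    ((TopologicalSpace.isOpen_of_mem_countableBasis p.1.2).measurableSet.inter (hKm p.2))
  -- For non-measurable `A`, the outer probability of `A` under the image law may exceed that of its
  -- preimage, so the inclusion of events alone is not enough. Conditionally on `F = S`, the kernel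
  -- `k S` is carried by the fibre of `F` over `S` for almost every `S`, because countably many
  -- counts identify `S`. Hence `k S E = 1` for almost every `S` in `A`, and integrating `k S E`
  -- gives the bound.
  let k : Kernel (Config X) Ω := condDistrib id F ρ
  have hk : (ρ.map F) ⊗ₘ k = ρ.map (fun ω => (F ω, ω)) :=
    compProd_map_condDistrib aemeasurable_id
  have hFm : Measurable fun ω => (F ω, ω) := hF.prodMk measurable_id
  have hgood' := ae_of_ae_map hF.aemeasurable hgood
  have h1 : ∀ᵐ p ∂((ρ.map F) ⊗ₘ k), c p.1 = c (F p.2) := by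
    rw [hk, ae_map_iff hFm.aemeasurable]
    · exact ae_of_all _ fun ω => rfl
    · exact measurableSet_eq_fun (hc.comp measurable_fst) (hc.comp (hF.comp measurable_snd))
  obtain ⟨N, hNsub, hNm, hN0⟩ := exists_measurable_superset_of_null
    (show ρ {ω | ¬ ((F ω ∈ A → ω ∈ E) ∧ (F ω).points ⊆ ⋃ n, K n ∧ ∀ n, (F ω).count (K n) < ⊤)} = 0
      from (hAE.and hgood'))
  have h2 : ∀ᵐ p ∂((ρ.map F) ⊗ₘ k), p.2 ∉ N := by
    have hset : MeasurableSet {p : Config X × Ω | p.2 ∉ N} := measurable_snd hNm.compl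
    rw [hk, ae_map_iff hFm.aemeasurable hset]
    exact measure_eq_zero_iff_ae_notMem.1 hN0
  have hone : ∀ᵐ S ∂(ρ.map F), S ∈ A → k S E = 1 := by
    filter_upwards [Measure.ae_ae_of_ae_compProd h1, Measure.ae_ae_of_ae_compProd h2, hgood]
      with S hS1 hS2 hS3 hSA
    rw [← prob_compl_eq_zero_iff hE]
    change ∀ᵐ ω ∂(k S), ω ∈ E
    filter_upwards [hS1, hS2] with ω hω1 hω2
    have hω : (F ω ∈ A → ω ∈ E) ∧ (F ω).points ⊆ ⋃ n, K n ∧ ∀ n, (F ω).count (K n) < ⊤ := by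
      by_contra hcon
      exact hω2 (hNsub hcon)
    have hSF : S = F ω := Config.eq_of_count_eq hS3.1 hω.2.1 hS3.2 hω.2.2
      fun U hU n => congrFun hω1 (⟨U, hU⟩, n)
    exact hω.1 (hSF ▸ hSA)
  calc ρ.map F A ≤ ρ.map F {S | 1 ≤ k S E} := measure_mono_ae (by
        filter_upwards [hone] with S hS hSA using (hS hSA).ge)
    _ ≤ ∫⁻ S, k S E ∂(ρ.map F) := by
        simpa using mul_meas_ge_le_lintegral (μ := ρ.map F) (k.measurable_coe hE) 1
    _ = ((ρ.map F) ⊗ₘ k) (univ ×ˢ E) := by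
        rw [Measure.compProd_apply_prod MeasurableSet.univ hE, Measure.restrict_univ]
    _ = ρ E := by
        rw [hk, Measure.map_apply hFm (MeasurableSet.univ.prod hE)]
        congr 1
        ext ω
        simp

/-! ### Sampling a Poisson point process -/

namespace PoissonSample

/-- The sample space: a sequence of numbers of points, and a double sequence of points. -/
abbrev Space (Y : Type*) : Type _ := (ℕ → ℕ) × ((_ : ℕ) × ℕ → Y)

variable {Y : Type*}

/-- The indices of the sampled points that lie in `T`. -/
def index (T : Set Y) (ω : Space Y) : Set ((_ : ℕ) × ℕ) := {p | p.2 < ω.1 p.1 ∧ ω.2 p ∈ T}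

lemma measurableSet_mem_index [MeasurableSpace Y] {T : Set Y} (hT : MeasurableSet T)
    (p : (_ : ℕ) × ℕ) : MeasurableSet {ω : Space Y | p ∈ index T ω} := by
  have h1 : Measurable fun ω : Space Y => ω.1 p.1 := by fun_prop
  have h2 : Measurable fun ω : Space Y => ω.2 p := by fun_prop
  exact (measurableSet_lt measurable_const h1).inter (h2 hT)

lemma measurable_encard_index [MeasurableSpace Y] {T : Set Y} (hT : MeasurableSet T) :
    Measurable fun ω : Space Y => (index T ω).encard := by
  have h : Measurable fun ω : Space Y => ((index T ω).encard : ℝ≥0∞) := by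
    have : (fun ω : Space Y => ((index T ω).encard : ℝ≥0∞))
        = fun ω => ∑' p, {ω : Space Y | p ∈ index T ω}.indicator (fun _ => 1) ω := by
      funext ω
      rw [← ENNReal.tsum_set_one, tsum_subtype (index T ω) fun _ => (1 : ℝ≥0∞)]
      rfl
    rw [this]
    exact Measurable.tsum fun p =>
      measurable_const.indicator (measurableSet_mem_index hT p)
  refine measurable_to_countable' fun a => ?_
  convert! h (measurableSet_singleton (a : ℝ≥0∞)) using 1
  ext ω
  simp

/-- The partial products are `2^{-N}` with `N` the count in the first `m` families; if the total
count is infinite they tend to `0`, the value of `halfPow` at `⊤`. -/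
lemma tendsto_prod_halfPow_index (T : Set Y) (ω : Space Y) :
    Tendsto (fun m => ∏ n ∈ Finset.range m, ∏ i ∈ Finset.range (ω.1 n),
      open Classical in if ω.2 ⟨n, i⟩ ∈ T then (2⁻¹ : ℝ≥0∞) else 1) atTop
      (𝓝 (halfPow (index T ω).encard)) := by
  classical
  let s : ℕ → Finset ((_ : ℕ) × ℕ) := fun m =>
    ((Finset.range m).sigma fun n => Finset.range (ω.1 n)).filter fun p => ω.2 p ∈ T
  have hs : ∀ m p, p ∈ s m ↔ p.1 < m ∧ p ∈ index T ω := by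
    intro m p
    simp [s, index, and_assoc]
  have hprod : ∀ m, ∏ n ∈ Finset.range m, ∏ i ∈ Finset.range (ω.1 n),
      (if ω.2 ⟨n, i⟩ ∈ T then (2⁻¹ : ℝ≥0∞) else 1) = halfPow (s m).card := by
    intro m
    rw [Finset.prod_sigma', halfPow_coe, Finset.prod_ite]
    simp [s]
  have hle : ∀ m, ((s m).card : ℕ∞) ≤ (index T ω).encard := by
    intro m
    rw [← encard_coe_eq_coe_finsetCard]
    exact encard_le_encard fun p hp => ((hs m p).1 hp).2
  have hexh : ∀ t : Finset ((_ : ℕ) × ℕ), ↑t ⊆ index T ω → ∃ m, ∀ m' ≥ m, t ⊆ s m' := by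
    intro t ht
    refine ⟨t.sup (fun p => p.1 + 1), fun m' hm' p hp => (hs m' p).2 ⟨?_, ht hp⟩⟩
    exact Nat.lt_of_succ_le ((Finset.le_sup (f := fun p : (_ : ℕ) × ℕ => p.1 + 1) hp).trans hm')
  simp_rw [hprod]
  by_cases hfin : (index T ω).Finite
  · obtain ⟨m, hm⟩ := hexh hfin.toFinset (by simp)
    refine tendsto_const_nhds.congr' ?_
    filter_upwards [eventually_ge_atTop m] with m' hm'
    congr 1
    refine le_antisymm ?_ (hle m')
    rw [hfin.encard_eq_coe_toFinset_card]
    exact_mod_cast Finset.card_le_card (hm m' hm')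
  · rw [show (index T ω).encard = ⊤ from encard_eq_top hfin, halfPow_top]
    refine tendsto_order.2 ⟨fun a ha => absurd ha (by simp), fun a ha => ?_⟩
    obtain ⟨r, hr⟩ := (((ENNReal.tendsto_pow_atTop_nhds_zero_of_lt_one
      (r := 2⁻¹) (by simp)).eventually (gt_mem_nhds ha))).exists
    obtain ⟨t, ht, htr⟩ := Set.Infinite.exists_subset_card_eq hfin r
    obtain ⟨m, hm⟩ := hexh t ht
    filter_upwards [eventually_ge_atTop m] with m' hm'
    refine lt_of_le_of_lt ?_ hr
    rw [← halfPow_coe]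
    exact halfPow_antitone (by exact_mod_cast htr ▸ Finset.card_le_card (hm m' hm'))

variable [MeasurableSpace Y]

lemma measurable_prod_points {h : Y → ℝ≥0∞} (hh : Measurable h) (m : ℕ) :
    Measurable fun ω : Space Y =>
      ∏ n ∈ Finset.range m, ∏ i ∈ Finset.range (ω.1 n), h (ω.2 ⟨n, i⟩) := by
  refine Finset.measurable_fun_prod _ fun n _ => ?_
  -- The number of factors is random; it is made a separate discrete variable and measurability is
  -- checked for each of its values.
  let g : ℕ × ((_ : ℕ) × ℕ → Y) → ℝ≥0∞ := fun q => ∏ i ∈ Finset.range q.1, h (q.2 ⟨n, i⟩)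
  have hg : Measurable g := measurable_from_prod_countable_right fun k =>
    Finset.measurable_fun_prod (Finset.range k) fun i _ =>
      hh.comp (measurable_pi_apply (⟨n, i⟩ : (_ : ℕ) × ℕ))
  have hpair : Measurable fun ω : Space Y => (ω.1 n, ω.2) :=
    ((measurable_pi_apply n).comp measurable_fst).prodMk measurable_snd
  exact hg.comp hpair

section

variable [Nonempty Y] (Γ : Measure Y) [SFinite Γ]

/-- The mean number of points in the `n`-th family. -/
def mean (n : ℕ) : ℝ≥0 := (sfiniteSeq Γ n univ).toNNReal

open Classical in
/-- The law of a point of the `n`-th family. -/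
def pointLaw (n : ℕ) : Measure Y :=
  if sfiniteSeq Γ n = 0 then Measure.dirac (Classical.arbitrary Y) else (sfiniteSeq Γ n)[|univ]

instance (n : ℕ) : IsProbabilityMeasure (pointLaw Γ n) := by
  unfold pointLaw
  split_ifs with h
  · infer_instance
  · exact cond_isProbabilityMeasure (by simpa using h)

lemma mean_smul_pointLaw (n : ℕ) : (mean Γ n : ℝ≥0∞) • pointLaw Γ n = sfiniteSeq Γ n := by
  unfold mean pointLaw
  rw [ENNReal.coe_toNNReal (measure_ne_top _ _)]
  split_ifs with h
  · simp [h]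
  · rw [ProbabilityTheory.cond, Measure.restrict_univ, smul_smul, ENNReal.mul_inv_cancel, one_smul]
    · simpa using h
    · exact measure_ne_top _ _

/-- The law of the sample: the numbers of points are independent Poisson variables, and the points
are independent and independent of the numbers. -/
def law : Measure (Space Y) :=
  (Measure.infinitePi fun n => poissonMeasure (mean Γ n)).prod
    (Measure.infinitePi fun p : (_ : ℕ) × ℕ => pointLaw Γ p.1)

instance : IsProbabilityMeasure (law Γ) := by unfold law; infer_instance

variable {Γ}

/-- Given the numbers of points, independence turns the product into powers of `∫ h`; averaging over
the Poisson numbers gives the exponential. Restricting to `m` families keeps the products finite. -/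
lemma lintegral_prod_points {h : Y → ℝ≥0∞} (hh : Measurable h) (h1 : ∀ y, h y ≤ 1) (m : ℕ) :
    ∫⁻ ω, ∏ n ∈ Finset.range m, ∏ i ∈ Finset.range (ω.1 n), h (ω.2 ⟨n, i⟩) ∂(law Γ)
      = expNeg (∑ n ∈ Finset.range m, ∫⁻ y, (1 - h y) ∂(sfiniteSeq Γ n)) := by
  have hx : ∀ n, ∫⁻ y, h y ∂(pointLaw Γ n) ≤ 1 := fun n =>
    (lintegral_mono h1).trans (by simp)
  unfold law
  rw [lintegral_prod _ (measurable_prod_points hh m).aemeasurable]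
  have hinner : ∀ N : ℕ → ℕ,
      ∫⁻ y, ∏ n ∈ Finset.range m, ∏ i ∈ Finset.range (N n), h (y ⟨n, i⟩)
        ∂(Measure.infinitePi fun p : (_ : ℕ) × ℕ => pointLaw Γ p.1)
      = ∏ n ∈ Finset.range m, (∫⁻ y, h y ∂(pointLaw Γ n)) ^ N n := by
    intro N
    simp_rw [Finset.prod_sigma']
    rw [lintegral_prod_eq_prod_lintegral_of_indepFun _ 
      (fun (p : (_ : ℕ) × ℕ) (y : (_ : ℕ) × ℕ → Y) => h (y p))
      (iIndepFun_infinitePi (X := fun _ => h) fun _ => hh)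
      (fun p => hh.comp (measurable_pi_apply p)), Finset.prod_sigma]
    refine Finset.prod_congr rfl fun n _ => ?_
    rw [Finset.prod_congr rfl fun i _ => (measurePreserving_eval_infinitePi
      (fun p : (_ : ℕ) × ℕ => pointLaw Γ p.1) ⟨n, i⟩).lintegral_comp hh]
    simp
  simp_rw [hinner]
  rw [lintegral_prod_eq_prod_lintegral_of_indepFun _
      (fun n (N : ℕ → ℕ) => (∫⁻ y, h y ∂(pointLaw Γ n)) ^ N n)
      (iIndepFun_infinitePi (X := fun n k => (∫⁻ y, h y ∂(pointLaw Γ n)) ^ k)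
        fun _ => measurable_of_countable _)
      (fun n => (measurable_of_countable fun k : ℕ => (∫⁻ y, h y ∂(pointLaw Γ n)) ^ k).comp
        (measurable_pi_apply n)), expNeg_sum]
  refine Finset.prod_congr rfl fun n _ => ?_
  rw [(measurePreserving_eval_infinitePi (fun n => poissonMeasure (mean Γ n)) n).lintegral_comp
    (measurable_of_countable fun k : ℕ => (∫⁻ y, h y ∂(pointLaw Γ n)) ^ k),
    lintegral_pow_poissonMeasure _ (hx n), ← mean_smul_pointLaw Γ n, lintegral_smul_measure,
    lintegral_sub hh ((hx n).trans_lt ENNReal.one_lt_top).ne (ae_of_all _ h1)]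
  simp

/-- The numbers of sampled points in disjoint sets are independent Poisson variables. -/
lemma map_encard_index {ι : Type*} [Fintype ι] {T : ι → Set Y} (hT : ∀ i, MeasurableSet (T i))
    (hd : Pairwise fun i i' => Disjoint (T i) (T i')) :
    (law Γ).map (fun ω i => (index (T i) ω).encard)
      = Measure.pi fun i => poissonENat (Γ (T i)) := by
  classical
  have hmeas : Measurable fun (ω : Space Y) i => (index (T i) ω).encard :=
    measurable_pi_lambda _ fun i => measurable_encard_index (hT i)
  have := Measure.isProbabilityMeasure_map (μ := law Γ) hmeas.aemeasurable
  refine enat_pi_ext _ _ fun m => ?_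
  rw [lintegral_map (measurable_of_countable _) hmeas,
    lintegral_prod_eq_prod_lintegral_of_indepFun _ (fun i (x : ι → ℕ∞) => halfPow (x i) ^ m i)
      (iIndepFun_pi (X := fun i n => halfPow n ^ m i)
        fun i => (measurable_of_countable _).aemeasurable) (fun i => measurable_of_countable _),
    Finset.prod_congr rfl fun i _ => (measurePreserving_eval
      (fun i => poissonENat (Γ (T i))) i).lintegral_comp
        (measurable_of_countable fun n => halfPow n ^ m i)]
  simp_rw [lintegral_halfPow_poissonENat]
  rw [← expNeg_sum]
  -- The product of `h` over all sampled points is the joint generating function of the counts. As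
  -- the `T i` are disjoint, `1 - h` is a sum of multiples of indicators, so the exponent splits
  -- over `i`.
  let h : Y → ℝ≥0∞ := fun y => ∏ i, (if y ∈ T i then (2⁻¹ : ℝ≥0∞) else 1) ^ m i
  have hh : Measurable h := Finset.measurable_fun_prod _ fun i _ =>
    (Measurable.ite (hT i) measurable_const measurable_const).pow_const _
  have h1 : ∀ y, h y ≤ 1 := fun y => Finset.prod_le_one' fun i _ =>
    pow_le_one₀ (by simp) (by split_ifs <;> simp)
  have hsub : ∀ y, 1 - h y = ∑ i, (T i).indicator (fun _ => 1 - (2⁻¹ : ℝ≥0∞) ^ m i) y := by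
    intro y
    by_cases hy : ∃ i, y ∈ T i
    · obtain ⟨i, hi⟩ := hy
      have hne : ∀ i', i' ≠ i → y ∉ T i' := fun i' hi' hy' =>
        Set.disjoint_left.1 (hd hi') hy' hi
      rw [Finset.sum_eq_single i (fun i' _ hi' => by simp [hne i' hi']) (by simp)]
      simp only [h]
      rw [Finset.prod_eq_single i (fun i' _ hi' => by simp [hne i' hi']) (by simp)]
      simp [hi]
    · push Not at hy
      simp [h, hy]
  have hint : ∑' n, ∫⁻ y, (1 - h y) ∂(sfiniteSeq Γ n) = ∑ i, Γ (T i) * (1 - 2⁻¹ ^ m i) := by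
    rw [← lintegral_sum_measure, sum_sfiniteSeq]
    simp_rw [hsub]
    rw [lintegral_finsetSum _ fun i _ => measurable_const.indicator (hT i)]
    refine Finset.sum_congr rfl fun i _ => ?_
    rw [lintegral_indicator_const (hT i), mul_comm]
  rw [← hint]
  have hlim : ∀ ω : Space Y, Tendsto (fun r => ∏ n ∈ Finset.range r, ∏ i ∈ Finset.range (ω.1 n),
      h (ω.2 ⟨n, i⟩)) atTop (𝓝 (∏ i, halfPow (index (T i) ω).encard ^ m i)) := by
    intro ω
    have : ∀ r, ∏ n ∈ Finset.range r, ∏ i ∈ Finset.range (ω.1 n), h (ω.2 ⟨n, i⟩)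
        = ∏ j, (∏ n ∈ Finset.range r, ∏ i ∈ Finset.range (ω.1 n),
          if ω.2 ⟨n, i⟩ ∈ T j then (2⁻¹ : ℝ≥0∞) else 1) ^ m j := by
      intro r
      simp_rw [h, ← Finset.prod_pow]
      rw [Finset.prod_comm (s := Finset.univ)]
      refine Finset.prod_congr rfl fun n _ => ?_
      rw [Finset.prod_comm]
    simp_rw [this]
    have hfin : ∀ n, halfPow n ≠ ∞ := fun n => ((halfPow_le_one n).trans_lt ENNReal.one_lt_top).ne
    refine ENNReal.tendsto_finsetProd_of_ne_top _ (fun i _ => ?_)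
      fun i _ => ENNReal.pow_ne_top (hfin _)
    convert! ENNReal.Tendsto.pow (tendsto_prod_halfPow_index (T i) ω)
  have hL : Tendsto (fun r => ∫⁻ ω, ∏ n ∈ Finset.range r, ∏ i ∈ Finset.range (ω.1 n),
      h (ω.2 ⟨n, i⟩) ∂(law Γ)) atTop
      (𝓝 (∫⁻ ω, ∏ i, halfPow (index (T i) ω).encard ^ m i ∂(law Γ))) := by
    refine tendsto_lintegral_of_dominated_convergence (fun _ => 1)
      (fun r => measurable_prod_points hh r) (fun r => ae_of_all _ fun ω => ?_) (by simp)
      (ae_of_all _ hlim)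
    change ∏ n ∈ Finset.range r, ∏ i ∈ Finset.range (ω.1 n), h (ω.2 ⟨n, i⟩) ≤ 1
    exact Finset.prod_le_one' fun n _ => Finset.prod_le_one' fun i _ => h1 _
  refine tendsto_nhds_unique hL ?_
  simp_rw [lintegral_prod_points hh h1]
  exact (continuous_expNeg.tendsto _).comp (ENNReal.tendsto_nat_tsum _)

end

end PoissonSample

/-! ### Images of the sampled points as a Poisson process -/

namespace PoissonSample

variable {X Y : Type*}

/-- The images under `f` of the sampled points that lie in `D`. -/
def config (f : Y → X) (D : Set Y) (ω : Space Y) : Config X :=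
  (fun p => f (ω.2 p)) '' index D ω

/-- A configuration is a set and forgets multiplicities, so injectivity is what equates its count
with the number of indices. -/
lemma count_config {f : Y → X} {D : Set Y} {ω : Space Y}
    (h : InjOn (fun p => f (ω.2 p)) (index D ω)) (B : Set X) :
    (config f D ω).count B = (index (D ∩ f ⁻¹' B) ω).encard := by
  have : (config f D ω).points ∩ B = (fun p => f (ω.2 p)) '' index (D ∩ f ⁻¹' B) ω := by
    ext x
    constructor
    · rintro ⟨⟨p, ⟨hp, hpD⟩, rfl⟩, hx⟩
      exact ⟨p, ⟨hp, hpD, hx⟩, rfl⟩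
    · rintro ⟨p, ⟨hp, hpD, hx⟩, rfl⟩
      exact ⟨⟨p, ⟨hp, hpD⟩, rfl⟩, hx⟩
  unfold Config.count
  rw [this]
  have hsub : index (D ∩ f ⁻¹' B) ω ⊆ index D ω := fun p hp => ⟨hp.1, hp.2.1⟩
  exact (h.mono hsub).encard_image

variable [MeasurableSpace X] [MeasurableEq X] [MeasurableSpace Y] {f : Y → X} {D : Set Y}

lemma measurableSet_injOn (hf : Measurable f) (hD : MeasurableSet D) :
    MeasurableSet {ω : Space Y | InjOn (fun p => f (ω.2 p)) (index D ω)} := by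
  have : {ω : Space Y | InjOn (fun p => f (ω.2 p)) (index D ω)}
      = ⋂ p, ⋂ q, {ω | p ∈ index D ω}ᶜ ∪ {ω | q ∈ index D ω}ᶜ ∪
        {ω | f (ω.2 p) = f (ω.2 q)}ᶜ ∪ {_ω | p = q} := by
    ext ω
    simp only [InjOn, mem_ofPred_eq, mem_iInter, mem_union, mem_compl_iff]
    grind
  rw [this]
  refine MeasurableSet.iInter fun p => MeasurableSet.iInter fun q => ?_
  refine ((((measurableSet_mem_index hD p).compl).union
    (measurableSet_mem_index hD q).compl).union ?_).union (MeasurableSet.const _)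
  exact (measurableSet_eq_fun (by fun_prop) (by fun_prop)).compl

variable [Nonempty Y] {Γ : Measure Y} [SFinite Γ]

/-- Two points with distinct indices are independent; fixing the second, the first falls in `D` with
the same image with probability zero, since the image measure has no atoms. -/
lemma ae_injOn (hf : Measurable f) (hD : MeasurableSet D)
    (h0 : ∀ x, (Γ.restrict D).map f {x} = 0) :
    ∀ᵐ ω ∂(law Γ), InjOn (fun p => f (ω.2 p)) (index D ω) := by
  have key : ∀ p q : (_ : ℕ) × ℕ, p ≠ q →
      ∀ᵐ ω ∂(law Γ), p ∈ index D ω → q ∈ index D ω → f (ω.2 p) ≠ f (ω.2 q) := by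
    intro p q hpq
    -- In a family of mean zero the point law is an arbitrary Dirac mass and ties are possible, but
    -- no index of that family is almost surely ever used.
    by_cases hm : mean Γ p.1 = 0
    · have h1 : ∀ᵐ N ∂(Measure.infinitePi fun n => poissonMeasure (mean Γ n)), N p.1 = 0 := by
        refine (measurePreserving_eval_infinitePi
          (fun n => poissonMeasure (mean Γ n)) p.1).quasiMeasurePreserving.ae (p := fun k => k = 0) ?_
        rw [hm]
        refine (prob_compl_eq_zero_iff (measurableSet_singleton 0)).2 ?_
        simp [poissonMeasure_singleton]
      have h2 : ∀ᵐ ω ∂(law Γ), ω.1 p.1 = 0 := Measure.quasiMeasurePreserving_fst.ae h1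
      filter_upwards [h2] with ω hω hp
      exact absurd hp.1 (by simp [hω])
    · let ρ := Measure.infinitePi fun p : (_ : ℕ) × ℕ => pointLaw Γ p.1
      have hlaw : ρ.map (fun y => (y p, y q)) = (pointLaw Γ p.1).prod (pointLaw Γ q.1) := by
        have hind := (iIndepFun_infinitePi (P := fun p : (_ : ℕ) × ℕ => pointLaw Γ p.1)
          (X := fun _ => id) fun _ => measurable_id).indepFun hpq
        have := (indepFun_iff_map_prod_eq_prod_map_map (measurable_pi_apply p).aemeasurable
          (measurable_pi_apply q).aemeasurable).1 hind
        rwa [Measure.infinitePi_map_eval, Measure.infinitePi_map_eval] at this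
      have hset : MeasurableSet {z : Y × Y | z.1 ∈ D ∧ f z.1 = f z.2} :=
        (measurable_fst hD).inter
          (measurableSet_eq_fun (hf.comp measurable_fst) (hf.comp measurable_snd))
      have hle : sfiniteSeq Γ p.1 ≤ Γ := by
        conv_rhs => rw [← sum_sfiniteSeq Γ]
        exact Measure.le_sum _ _
      have h1 : ∀ᵐ z ∂((pointLaw Γ p.1).prod (pointLaw Γ q.1)),
          z ∉ {z : Y × Y | z.1 ∈ D ∧ f z.1 = f z.2} := by
        rw [← measure_eq_zero_iff_ae_notMem, Measure.prod_apply_symm hset]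
        refine (lintegral_congr fun y => ?_).trans lintegral_zero
        have h2 : Γ (f ⁻¹' {f y} ∩ D) = 0 := by
          have hms : MeasurableSet {f y} := MeasurableSet.singleton _
          have := h0 (f y)
          rwa [Measure.map_apply hf hms, Measure.restrict_apply (hf hms)] at this
        have h3 : (mean Γ p.1 : ℝ≥0∞) * pointLaw Γ p.1 (f ⁻¹' {f y} ∩ D) = 0 := by
          rw [← smul_eq_mul, ← Measure.smul_apply, mean_smul_pointLaw]
          exact le_antisymm ((hle _).trans h2.le) zero_le
        rcases mul_eq_zero.1 h3 with h4 | h4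
        · exact absurd (by exact_mod_cast h4) hm
        · refine measure_mono_null ?_ h4
          rintro x ⟨hx, hxy⟩
          exact ⟨hxy, hx⟩
      rw [← hlaw, ae_map_iff (by fun_prop) hset.compl] at h1
      have h2 : ∀ᵐ ω ∂(law Γ), (ω.2 p, ω.2 q) ∉ {z : Y × Y | z.1 ∈ D ∧ f z.1 = f z.2} :=
        Measure.quasiMeasurePreserving_snd.ae h1
      filter_upwards [h2] with ω hω hp hq heq
      exact hω ⟨hp.2, heq⟩
  filter_upwards [ae_all_iff.2 fun p => ae_all_iff.2 fun q => ae_all_iff.2 fun h => key p q h]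
    with ω hω p hp q hq heq
  by_contra hpq
  exact hω p q hpq hp hq heq

/-- The images of the sampled points form a Poisson process whose intensity is the image measure,
provided the latter has no atoms. -/
lemma exists_config (hf : Measurable f) (hD : MeasurableSet D)
    (h0 : ∀ x, (Γ.restrict D).map f {x} = 0) :
    ∃ F : Space Y → Config X, Measurable F ∧ (∀ᵐ ω ∂(law Γ), F ω = config f D ω) ∧
      HasPoissonCounts ((Γ.restrict D).map f) ((law Γ).map F) := by
  classical
  let I := {ω : Space Y | InjOn (fun p => f (ω.2 p)) (index D ω)}
  have hI : MeasurableSet I := measurableSet_injOn hf hD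
  -- Replacing the configuration by the empty one where ties occur makes every count measurable.
  let F : Space Y → Config X := fun ω => if ω ∈ I then config f D ω else (∅ : Set X)
  have hcount : ∀ B, (fun ω => (F ω).count B)
      = fun ω => if ω ∈ I then (index (D ∩ f ⁻¹' B) ω).encard else 0 := by
    intro B
    funext ω
    by_cases hω : ω ∈ I
    · simp only [F, hω, if_true]
      exact count_config hω B
    · simp only [F, hω, if_false]
      simp [Config.count, Config.points]
  have hF : Measurable F := by
    refine Config.measurable_of_measurable_count fun B hB => ?_
    rw [hcount]
    exact Measurable.ite hI (measurable_encard_index (hD.inter (hf hB))) measurable_const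
  have hae : ∀ᵐ ω ∂(law Γ), ω ∈ I := ae_injOn hf hD h0
  refine ⟨F, hF, ?_, ?_⟩
  · filter_upwards [hae] with ω hω
    simp [F, hω]
  · intro k B hB hd
    have hm : Measurable fun (S : Config X) i => S.count (B i) :=
      measurable_pi_lambda _ fun i => Config.measurable_count (hB i)
    rw [Measure.map_map hm hF]
    have hT : ∀ i, MeasurableSet (D ∩ f ⁻¹' (B i)) := fun i => hD.inter (hf (hB i))
    have hL := map_encard_index (Γ := Γ) hT fun i i' h =>
      ((hd h).preimage f).mono inter_subset_right inter_subset_right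
    have hΛ : ∀ i, (Γ.restrict D).map f (B i) = Γ (D ∩ f ⁻¹' (B i)) := fun i => by
      rw [Measure.map_apply hf (hB i), Measure.restrict_apply (hf (hB i)), inter_comm]
    simp_rw [hΛ]
    rw [← hL]
    refine Measure.map_congr ?_
    filter_upwards [hae] with ω hω
    funext i
    exact (congrFun (hcount (B i)) ω).trans (if_pos hω)

end PoissonSample

/-- A coupling bound for the outer probabilities of two events under two Poisson laws whose
intensities are images of restrictions of the same measure. -/
lemma IsPoissonLaw.le_of_coupling {X Y : Type*} [MeasurableSpace X] [TopologicalSpace X]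
    [OpensMeasurableSpace X] [MeasurableEq X] [T1Space X] [SecondCountableTopology X]
    [MeasurableSpace Y] [StandardBorelSpace Y] [Nonempty Y] (Γ : Measure Y) [SFinite Γ]
    {f g : Y → X} {D C : Set Y} (hf : Measurable f) (hg : Measurable g) (hD : MeasurableSet D)
    (hC : MeasurableSet C) {Λ Λ' : Measure X} [SigmaFinite Λ]
    (hfΛ : (Γ.restrict D).map f = Λ) (hgΛ : (Γ.restrict C).map g = Λ')
    (h0 : ∀ x, Λ {x} = 0) (h0' : ∀ x, Λ' {x} = 0) {P Q : Measure (Config X)}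
    (hP : IsPoissonLaw Λ P) (hQ : IsPoissonLaw Λ' Q) {A A' : Set (Config X)}
    (h : ∀ ω, PoissonSample.config f D ω ∈ A → PoissonSample.config g C ω ∈ A') :
    P A ≤ Q A' := by
  have := hP.isProbabilityMeasure
  have := hQ.isProbabilityMeasure
  obtain ⟨F, hF, hFae, hFP⟩ := PoissonSample.exists_config (Γ := Γ) hf hD (hfΛ ▸ h0)
  obtain ⟨G, hG, hGae, hGP⟩ := PoissonSample.exists_config (Γ := Γ) hg hC (hgΛ ▸ h0')
  have := Measure.isProbabilityMeasure_map (μ := PoissonSample.law Γ) hF.aemeasurable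
  have := Measure.isProbabilityMeasure_map (μ := PoissonSample.law Γ) hG.aemeasurable
  rw [hfΛ] at hFP
  rw [hgΛ] at hGP
  have hPF : (PoissonSample.law Γ).map F = P := hFP.unique hP.hasPoissonCounts
  have hQG : (PoissonSample.law Γ).map G = Q := hGP.unique hQ.hasPoissonCounts
  -- A measurable hull of `A'` has the same outer probability, so only `A` is left non-measurable.
  obtain ⟨E, hAE, hE, hQE⟩ := exists_measurable_superset Q A'
  rw [← hQE, ← hQG, Measure.map_apply hG hE, ← hPF]
  refine IsPoissonLaw.map_le_of_preimage_subset (Λ := Λ) hF (hPF ▸ hP) (hG hE) ?_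
  filter_upwards [hFae, hGae] with ω hω hω' hA
  refine hAE ?_
  rw [hω']
  exact h ω (hω ▸ hA)

/-! ### Quantile functions -/

/-- The inverse of the tail `r ↦ σ [r, ∞)` on `(0, σ ℝ]`, extended by `0`. -/
def tailQuantile (σ : Measure ℝ) (u : ℝ) : ℝ :=
  if u ∈ Ioc 0 (σ.real univ) then sSup {r | u ≤ σ.real (Ici r)} else 0

section

variable {σ ρ : Measure ℝ} [IsFiniteMeasure σ] [IsFiniteMeasure ρ] {a b : ℝ}

/-- The tail `r ↦ σ [r, ∞)` is left-continuous, so the supremum is attained. The bounds `a`, `b` on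
the support make the set nonempty and bounded above, so that `sSup` is a genuine supremum. -/
lemma le_tailQuantile_iff (ha : σ (Iio a) = 0) (hb : σ (Ioi b) = 0) {u : ℝ}
    (hu : u ∈ Ioc 0 (σ.real univ)) (r : ℝ) : r ≤ tailQuantile σ u ↔ u ≤ σ.real (Ici r) := by
  have hanti : Antitone fun r => σ.real (Ici r) := fun r s hrs =>
    measureReal_mono (Ici_subset_Ici.2 hrs)
  have hne : ({r | u ≤ σ.real (Ici r)} : Set ℝ).Nonempty := by
    refine ⟨a, hu.2.trans (le_of_eq ?_)⟩
    rw [← compl_Iio]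
    exact (measureReal_congr (by
      rw [← ae_eq_empty] at ha
      simpa using ha.compl)).symm
  have hbdd : BddAbove {r | u ≤ σ.real (Ici r)} := by
    refine ⟨b, fun r hr => ?_⟩
    by_contra! hbr
    have : σ.real (Ici r) = 0 := by
      rw [measureReal_def, measure_mono_null (Ici_subset_Ioi.2 hbr) hb]
      rfl
    have hr' : u ≤ σ.real (Ici r) := hr
    linarith [hu.1]
  unfold tailQuantile
  rw [if_pos hu]
  refine ⟨fun hr => ?_, fun hr => le_csSup hbdd hr⟩
  have hlt : ∀ s, s < r → u ≤ σ.real (Ici s) := by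
    intro s hs
    obtain ⟨t, ht, hst⟩ := exists_lt_of_lt_csSup hne (hs.trans_le hr)
    exact le_trans ht (hanti hst.le)
  have hInter : Ici r = ⋂ n : ℕ, Ici (r - 1 / ((n : ℝ) + 1)) := by
    ext x
    simp only [mem_Ici, mem_iInter]
    constructor
    · intro h n
      have : 0 < 1 / ((n : ℝ) + 1) := Nat.one_div_pos_of_nat
      linarith
    · intro h
      by_contra! hx
      obtain ⟨n, hn⟩ := exists_nat_one_div_lt (sub_pos.2 hx)
      linarith [h n]
  have hlim := tendsto_measure_iInter_atTop (μ := σ)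
    (s := fun n : ℕ => Ici (r - 1 / ((n : ℝ) + 1))) (fun n => measurableSet_Ici.nullMeasurableSet)
    (fun m n hmn => Ici_subset_Ici.2 (sub_le_sub_left (Nat.one_div_le_one_div hmn) _))
    ⟨0, measure_ne_top _ _⟩
  rw [← hInter] at hlim
  have hlim' := (ENNReal.tendsto_toReal (measure_ne_top σ (Ici r))).comp hlim
  refine ge_of_tendsto' hlim' fun n => hlt _ ?_
  have : 0 < 1 / ((n : ℝ) + 1) := Nat.one_div_pos_of_nat
  linarith

lemma measurable_tailQuantile (ha : σ (Iio a) = 0) (hb : σ (Ioi b) = 0) :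
    Measurable (tailQuantile σ) := by
  refine measurable_of_Ici fun r => ?_
  have : tailQuantile σ ⁻¹' Ici r = (Ioc 0 (σ.real univ) ∩ Iic (σ.real (Ici r))) ∪
      ((Ioc 0 (σ.real univ))ᶜ ∩ {_u | r ≤ 0}) := by
    ext u
    by_cases hu : u ∈ Ioc 0 (σ.real univ)
    · simp only [mem_preimage, mem_Ici, le_tailQuantile_iff ha hb hu, mem_union, mem_inter_iff, hu,
        mem_compl_iff, mem_Iic]
      simp
    · have : tailQuantile σ u = 0 := if_neg hu
      simp only [mem_preimage, mem_Ici, this, mem_union, mem_inter_iff, hu, mem_compl_iff]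
      simp
  rw [this]
  exact (measurableSet_Ioc.inter measurableSet_Iic).union
    (measurableSet_Ioc.compl.inter (MeasurableSet.const _))

lemma map_tailQuantile (ha : σ (Iio a) = 0) (hb : σ (Ioi b) = 0) :
    (volume.restrict (Ioc 0 (σ.real univ))).map (tailQuantile σ) = σ := by
  have hm := measurable_tailQuantile ha hb
  refine (Measure.ext_of_Ici _ _ fun r => ?_).symm
  rw [Measure.map_apply hm measurableSet_Ici, Measure.restrict_apply (hm measurableSet_Ici)]
  have : tailQuantile σ ⁻¹' Ici r ∩ Ioc 0 (σ.real univ) = Ioc 0 (σ.real (Ici r)) := by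
    ext u
    constructor
    · rintro ⟨h1, h2⟩
      exact ⟨h2.1, (le_tailQuantile_iff ha hb h2 r).1 h1⟩
    · rintro ⟨h1, h2⟩
      have hu : u ∈ Ioc 0 (σ.real univ) := ⟨h1, h2.trans (measureReal_mono (subset_univ _))⟩
      exact ⟨(le_tailQuantile_iff ha hb hu r).2 h2, hu⟩
  rw [this, Real.volume_Ioc, sub_zero, measureReal_def, ENNReal.ofReal_toReal (measure_ne_top _ _)]

end

/-! ### Domination of radius measures -/

/-- `ν` is dominated by `ν'`: the atoms of `ν` can be matched to larger atoms of `ν'`. In the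
coupling `γ`, the part of `ν'` that is not matched is carried by `{(r, r') | r' < r}`. -/
def RadiusDominated (ν ν' : Measure ℝ) : Prop :=
  ∃ γ : Measure (ℝ × ℝ), SFinite γ ∧ (γ.restrict {p | p.1 ≤ p.2}).map Prod.fst = ν ∧
    γ.map Prod.snd = ν'

namespace RadiusDominated

lemma measurableSet_le' : MeasurableSet {p : ℝ × ℝ | p.1 ≤ p.2} :=
  measurableSet_le measurable_fst measurable_snd

lemma refl (ν : Measure ℝ) [SFinite ν] : RadiusDominated ν ν := by
  have hm : Measurable fun r : ℝ => (r, r) := by fun_prop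
  refine ⟨ν.map fun r => (r, r), inferInstance, ?_, ?_⟩
  · rw [Measure.restrict_map hm measurableSet_le', Measure.map_map measurable_fst hm]
    simp only [preimage_ofPred_eq, le_refl]
    simp [Function.comp_def]
  · rw [Measure.map_map measurable_snd hm]
    simp [Function.comp_def]

lemma zero_left (ν : Measure ℝ) [SFinite ν] : RadiusDominated 0 ν := by
  -- Pairing `r` with `r + 1` on the left leaves every atom unmatched.
  have hm : Measurable fun r : ℝ => (r + 1, r) := by fun_prop
  refine ⟨ν.map fun r => (r + 1, r), inferInstance, ?_, ?_⟩
  · rw [Measure.restrict_map hm measurableSet_le']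
    have : (fun r : ℝ => (r + 1, r)) ⁻¹' {p : ℝ × ℝ | p.1 ≤ p.2} = ∅ := by
      ext r
      simp
    simp [this]
  · rw [Measure.map_map measurable_snd hm]
    simp [Function.comp_def]

lemma add {ν₁ ν₂ ν₁' ν₂' : Measure ℝ} (h₁ : RadiusDominated ν₁ ν₁')
    (h₂ : RadiusDominated ν₂ ν₂') : RadiusDominated (ν₁ + ν₂) (ν₁' + ν₂') := by
  obtain ⟨γ₁, _, rfl, rfl⟩ := h₁
  obtain ⟨γ₂, _, rfl, rfl⟩ := h₂
  exact ⟨γ₁ + γ₂, inferInstance, by rw [Measure.restrict_add, Measure.map_add _ _ measurable_fst],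
    Measure.map_add _ _ measurable_snd⟩

lemma rescaleRadius {ν ν' : Measure ℝ} (h : RadiusDominated ν ν') (d : ℕ) {m : ℝ} (hm : 0 < m) :
    RadiusDominated (rescaleRadius d m ν) (rescaleRadius d m ν') := by
  obtain ⟨γ, _, rfl, rfl⟩ := h
  have hs : Measurable fun p : ℝ × ℝ => (p.1 / m, p.2 / m) := by fun_prop
  have hdiv : Measurable fun x : ℝ => x / m := by fun_prop
  refine ⟨ENNReal.ofReal (m ^ d) • γ.map fun p => (p.1 / m, p.2 / m), inferInstance, ?_, ?_⟩
  · have : (fun p : ℝ × ℝ => (p.1 / m, p.2 / m)) ⁻¹' {p | p.1 ≤ p.2} = {p | p.1 ≤ p.2} := by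
      ext p
      simp [div_le_div_iff_of_pos_right hm]
    rw [Measure.restrict_smul, Measure.restrict_map hs measurableSet_le', Measure.map_smul,
      Measure.map_map measurable_fst hs, this, _root_.rescaleRadius,
      Measure.map_map hdiv measurable_fst]
    rfl
  · rw [Measure.map_smul, Measure.map_map measurable_snd hs, _root_.rescaleRadius,
      Measure.map_map hdiv measurable_snd]
    rfl

/-- Comparison of tails implies domination. -/
lemma of_tail_le {ρ σ : Measure ℝ} [IsFiniteMeasure ρ] [IsFiniteMeasure σ] {a b : ℝ}
    (hρa : ρ (Iio a) = 0) (hρb : ρ (Ioi b) = 0) (hσa : σ (Iio a) = 0) (hσb : σ (Ioi b) = 0)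
    (h : ∀ r, ρ (Ici r) ≤ σ (Ici r)) : RadiusDominated ρ σ := by
  have htot : ∀ τ : Measure ℝ, τ (Iio a) = 0 → τ univ = τ (Ici a) := by
    intro τ hτ
    rw [← compl_Iio]
    refine (measure_congr ?_).symm
    rw [← ae_eq_empty] at hτ
    simpa using hτ.compl
  have hM : ρ.real univ ≤ σ.real univ := by
    refine ENNReal.toReal_mono (measure_ne_top _ _) ?_
    rw [htot ρ hρa, htot σ hσa]
    exact h a
  have hρm := measurable_tailQuantile hρa hρb
  have hσm := measurable_tailQuantile hσa hσb
  -- Both radii are read off at the same level `u`. Levels beyond the mass of `ρ` have no partner,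
  -- and `+ 1` puts them outside `{p | p.1 ≤ p.2}`.
  let φ : ℝ → ℝ × ℝ := fun u =>
    (if u ≤ ρ.real univ then tailQuantile ρ u else tailQuantile σ u + 1, tailQuantile σ u)
  have hφ : Measurable φ :=
    (Measurable.ite measurableSet_Iic hρm (hσm.add_const 1)).prodMk hσm
  have hset : φ ⁻¹' {p | p.1 ≤ p.2} ∩ Ioc 0 (σ.real univ) = Ioc 0 (ρ.real univ) := by
    ext u
    simp only [mem_inter_iff, mem_preimage, mem_ofPred_eq, φ]
    constructor
    · rintro ⟨h1, h2⟩
      refine ⟨h2.1, ?_⟩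
      by_contra h3
      rw [if_neg h3] at h1
      linarith
    · intro hu
      have hu' : u ∈ Ioc 0 (σ.real univ) := ⟨hu.1, hu.2.trans hM⟩
      refine ⟨?_, hu'⟩
      rw [if_pos hu.2, le_tailQuantile_iff hσa hσb hu']
      exact ((le_tailQuantile_iff hρa hρb hu _).1 le_rfl).trans
        (ENNReal.toReal_mono (measure_ne_top _ _) (h _))
  refine ⟨(volume.restrict (Ioc 0 (σ.real univ))).map φ, inferInstance, ?_, ?_⟩
  · rw [Measure.restrict_map hφ measurableSet_le', Measure.map_map measurable_fst hφ,
      Measure.restrict_restrict (hφ measurableSet_le'), hset]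
    conv_rhs => rw [← map_tailQuantile hρa hρb]
    refine Measure.map_congr ?_
    filter_upwards [ae_restrict_mem measurableSet_Ioc] with u hu
    exact if_pos hu.2
  · rw [Measure.map_map measurable_snd hφ]
    exact map_tailQuantile hσa hσb

end RadiusDominated

/-! ### Domination in the multiscale model -/

section

variable (d : ℕ)

lemma rescaleRadius_add {m : ℝ} (ν ν' : Measure ℝ) :
    rescaleRadius d m (ν + ν') = rescaleRadius d m ν + rescaleRadius d m ν' := by
  unfold rescaleRadius
  rw [Measure.map_add _ _ (by fun_prop), smul_add]

lemma rescaleRadius_sum {ι : Type*} {m : ℝ} (ν : ι → Measure ℝ) :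
    rescaleRadius d m (Measure.sum ν) = Measure.sum fun i => rescaleRadius d m (ν i) := by
  unfold rescaleRadius
  have hdiv : Measurable fun x : ℝ => x / m := by fun_prop
  ext s hs
  rw [Measure.smul_apply, Measure.map_apply hdiv hs, Measure.sum_apply _ (hdiv hs),
    Measure.sum_apply _ hs, smul_eq_mul, ← ENNReal.tsum_mul_left]
  refine tsum_congr fun i => ?_
  rw [Measure.smul_apply, Measure.map_apply hdiv hs, smul_eq_mul]

lemma rescaleRadius_finsetSum {ι : Type*} {m : ℝ} (s : Finset ι) (ν : ι → Measure ℝ) :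
    rescaleRadius d m (∑ i ∈ s, ν i) = ∑ i ∈ s, rescaleRadius d m (ν i) := by
  classical
  induction s using Finset.induction_on with
  | empty => simp [rescaleRadius]
  | insert a s ha ih => rw [Finset.sum_insert ha, Finset.sum_insert ha, rescaleRadius_add, ih]

lemma rescaleRadius_rescaleRadius {m n : ℝ} (hm : 0 < m) (ν : Measure ℝ) :
    rescaleRadius d m (rescaleRadius d n ν) = rescaleRadius d (m * n) ν := by
  unfold rescaleRadius
  rw [Measure.map_smul, Measure.map_map (by fun_prop) (by fun_prop), smul_smul,
    ← ENNReal.ofReal_mul (by positivity), mul_pow]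
  congr 2
  funext x
  simp [div_div, mul_comm]

lemma rescaleRadius_apply {m : ℝ} (ν : Measure ℝ) {s : Set ℝ} (hs : MeasurableSet s) :
    rescaleRadius d m ν s = ENNReal.ofReal (m ^ d) * ν ((fun x => x / m) ⁻¹' s) := by
  have hdiv : Measurable fun x : ℝ => x / m := by fun_prop
  rw [rescaleRadius, Measure.smul_apply, Measure.map_apply hdiv hs, smul_eq_mul]

instance {m : ℝ} (ν : Measure ℝ) [IsFiniteMeasure ν] : IsFiniteMeasure (rescaleRadius d m ν) := by
  constructor
  rw [rescaleRadius_apply d ν MeasurableSet.univ]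
  exact ENNReal.mul_lt_top ENNReal.ofReal_lt_top (measure_lt_top _ _)

lemma ScalingHyp.mul_le {d : ℕ} {μ : Measure ℝ} [IsFiniteMeasure μ] {κ₀ κ a r : ℝ}
    (hyp : ScalingHyp d μ κ₀) (hκ : κ₀ ≤ κ) (ha : κ ≤ a) (hr : 1 ≤ r) :
    ENNReal.ofReal (a ^ d) * μ (Icc (a * r) (a * κ)) ≤ μ (Icc r κ) := by
  have h : ENNReal.ofReal (a ^ d) * μ (Icc (a * r) (a * κ)) / μ (Icc r κ) ≤ 1 :=
    (le_iSup₂_of_le a ha (le_iSup₂_of_le (f := fun (r : ℝ) (_ : 1 ≤ r) =>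
      ENNReal.ofReal (a ^ d) * μ (Icc (a * r) (a * κ)) / μ (Icc r κ)) r hr le_rfl)).trans
      (hyp κ hκ)
  -- When the denominator vanishes, the convention `x / 0 = ∞` forces the numerator to vanish too.
  rcases eq_or_ne (μ (Icc r κ)) 0 with h0 | h0
  · rw [h0] at h ⊢
    by_contra hne
    rw [ENNReal.div_zero (fun h' => hne h'.le)] at h
    exact absurd h (by simp)
  · simpa using (ENNReal.div_le_iff h0 (measure_ne_top _ _)).1 h

variable {d} {μ : Measure ℝ} [IsFiniteMeasure μ] {κ₀ κ : ℝ}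

/-- The tail at `r` of the rescaled shell is at most `a ^ d * μ [a r', a κ]` with `r' = max r 1`,
which `ScalingHyp` bounds by `μ [r', κ]`, the tail of the right-hand measure. -/
lemma radiusDominated_rescale_shell (hκ₀ : 1 < κ₀) (hyp : ScalingHyp d μ κ₀) (hκ : κ₀ ≤ κ)
    {a : ℝ} (ha : κ ≤ a) :
    RadiusDominated (rescaleRadius d a (μ.restrict (Ioc a (a * κ)))) (μ.restrict (Icc 1 κ)) := by
  have ha0 : 0 < a := by linarith
  refine RadiusDominated.of_tail_le (a := 1) (b := κ) ?_ ?_ ?_ ?_ fun r => ?_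
  · rw [rescaleRadius_apply d _ measurableSet_Iio, Measure.restrict_apply (by measurability)]
    convert! mul_zero _
    convert! measure_empty (μ := μ)
    ext x
    simp only [mem_inter_iff, mem_preimage, mem_Iio, mem_Ioc, mem_empty_iff_false, iff_false]
    rw [div_lt_one ha0]
    rintro ⟨h1, h2, -⟩
    linarith
  · rw [rescaleRadius_apply d _ measurableSet_Ioi, Measure.restrict_apply (by measurability)]
    convert! mul_zero _
    convert! measure_empty (μ := μ)
    ext x
    simp only [mem_inter_iff, mem_preimage, mem_Ioi, mem_Ioc, mem_empty_iff_false, iff_false]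
    rw [lt_div_iff₀ ha0]
    rintro ⟨h1, -, h2⟩
    linarith [mul_comm a κ]
  · rw [Measure.restrict_apply measurableSet_Iio]
    convert! measure_empty (μ := μ)
    ext x
    simp only [mem_inter_iff, mem_Iio, mem_Icc, mem_empty_iff_false, iff_false]
    rintro ⟨h1, h2, -⟩
    linarith
  · rw [Measure.restrict_apply measurableSet_Ioi]
    convert! measure_empty (μ := μ)
    ext x
    simp only [mem_inter_iff, mem_Ioi, mem_Icc, mem_empty_iff_false, iff_false]
    rintro ⟨h1, -, h2⟩
    linarith
  · rw [rescaleRadius_apply d _ measurableSet_Ici, Measure.restrict_apply (by measurability),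
      Measure.restrict_apply measurableSet_Ici]
    have h1 : Ici r ∩ Icc 1 κ = Icc (max r 1) κ := by
      ext x
      simp [and_assoc]
    rw [h1]
    refine le_trans ?_ (hyp.mul_le hκ ha (le_max_right r 1))
    gcongr
    rintro x ⟨hx, hx1, hx2⟩
    refine ⟨?_, hx2⟩
    have hx' : r ≤ x / a := hx
    rw [← le_div_iff₀' ha0]
    exact max_le hx' ((one_le_div ha0).2 hx1.le)

/-- Induction on `j`: one more rescaling by `κ` moves the scales already filled up by one, and the
new outer shell, brought to size `[1, κ]` by `κ ^ j`, takes the freed first scale. -/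
lemma radiusDominated_rescale_restrict (hκ₀ : 1 < κ₀) (hyp : ScalingHyp d μ κ₀) (hκ : κ₀ ≤ κ)
    {j : ℕ} (hj : 1 ≤ j) :
    RadiusDominated (rescaleRadius d (κ ^ j) (μ.restrict (Icc 1 (κ ^ j))))
      (∑ n ∈ Finset.range j, rescaleRadius d (κ ^ (n + 1)) (μ.restrict (Icc 1 κ))) := by
  have hκ1 : 1 < κ := by linarith
  have hκ0 : 0 < κ := by linarith
  induction j, hj using Nat.le_induction with
  | base =>
    simpa using RadiusDominated.refl (rescaleRadius d κ (μ.restrict (Icc 1 κ)))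
  | succ j hj ih =>
    have hsplit : μ.restrict (Icc 1 (κ ^ (j + 1)))
        = μ.restrict (Icc 1 (κ ^ j)) + μ.restrict (Ioc (κ ^ j) (κ ^ j * κ)) := by
      rw [← Measure.restrict_union _ measurableSet_Ioc, ← pow_succ,
        Icc_union_Ioc_eq_Icc (one_le_pow₀ hκ1.le) (pow_le_pow_right₀ hκ1.le (Nat.le_succ j))]
      refine Set.disjoint_left.2 fun x hx hx' => ?_
      exact absurd hx'.1 (not_lt.2 hx.2)
    have hshell := radiusDominated_rescale_shell hκ₀ hyp hκ
      (le_self_pow₀ hκ1.le (Nat.one_le_iff_ne_zero.1 hj))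
    have h := (ih.rescaleRadius d hκ0).add (hshell.rescaleRadius d hκ0)
    rw [rescaleRadius_rescaleRadius d hκ0, rescaleRadius_rescaleRadius d hκ0,
      ← rescaleRadius_add, ← hsplit, ← pow_succ'] at h
    rw [Finset.sum_range_succ']
    convert! h using 2
    · rw [rescaleRadius_finsetSum]
      refine Finset.sum_congr rfl fun n _ => ?_
      rw [rescaleRadius_rescaleRadius d hκ0, ← pow_succ']
    · simp

end

/-! ### Truncations of the multiscale radius measure -/

section

variable {d : ℕ} {μ : Measure ℝ} {κ₀ κ : ℝ}

/-- Radii in `[1, κ]` divided by `κ ^ (i + 1)` are positive and at most `κ^{-i}`, a range that `s`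
avoids. -/
lemma rescaleRadius_scale_apply_eq_zero (hκ : 1 < κ) (i : ℕ) {s : Set ℝ} (hs : MeasurableSet s)
    (h : ∀ x ∈ s, 0 < x → κ ^ i * x ≤ 1 → False) :
    rescaleRadius d (κ ^ (i + 1)) (μ.restrict (Icc 1 κ)) s = 0 := by
  have hκ0 : 0 < κ := by linarith
  have hpow : 0 < κ ^ (i + 1) := by positivity
  rw [rescaleRadius_apply d _ hs, Measure.restrict_apply (by measurability)]
  convert! mul_zero _
  convert! measure_empty (μ := μ)
  ext x
  simp only [mem_inter_iff, mem_preimage, mem_Icc, mem_empty_iff_false, iff_false]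
  rintro ⟨h1, h2, h3⟩
  refine h _ h1 (div_pos (by linarith) hpow) ?_
  rw [mul_div_assoc', div_le_one hpow, pow_succ]
  exact mul_le_mul_of_nonneg_left h3 (by positivity)

lemma restrict_rescaleRadius_scale (hκ : 1 < κ) (i : ℕ) {t : ℝ} (ht : 1 ≤ t) :
    (rescaleRadius d (κ ^ (i + 1)) (μ.restrict (Icc 1 κ))).restrict (Ioc 0 t)
      = rescaleRadius d (κ ^ (i + 1)) (μ.restrict (Icc 1 κ)) := by
  refine Measure.restrict_eq_self_of_ae_mem ?_
  refine rescaleRadius_scale_apply_eq_zero hκ i measurableSet_Ioc.compl fun x hx hx0 hx1 => ?_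
  refine hx ⟨hx0, ?_⟩
  have : x ≤ κ ^ i * x := le_mul_of_one_le_left hx0.le (one_le_pow₀ hκ.le)
  linarith

lemma restrict_multiscaleRadius (hκ : 1 < κ) {t : ℝ} (ht : 1 ≤ t) :
    (multiscaleRadius d μ κ).restrict (Ioc 0 t) = μ.restrict (Ioc 0 t) +
      Measure.sum fun i : ℕ => rescaleRadius d (κ ^ (i + 1)) (μ.restrict (Icc 1 κ)) := by
  unfold multiscaleRadius
  rw [Measure.restrict_add, Measure.restrict_sum _ measurableSet_Ioc]
  simp_rw [restrict_rescaleRadius_scale hκ _ ht]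

variable [IsFiniteMeasure μ]

/-- Mass may be infinite near radius `0` only: above `κ^{-n}` just `μ` and the first `n` rescaled
copies contribute, each of finite mass. -/
lemma sigmaFinite_restrict_multiscaleRadius (hκ : 1 < κ) {t : ℝ} :
    SigmaFinite ((multiscaleRadius d μ κ).restrict (Ioc 0 t)) := by
  have hκ0 : 0 < κ := by linarith
  refine ⟨⟨⟨fun n => Iic 0 ∪ Ioi (κ⁻¹ ^ n), fun _ => trivial, fun n => ?_, ?_⟩⟩⟩
  · refine (measure_union_le _ _).trans_lt (ENNReal.add_lt_top.2 ⟨?_, ?_⟩)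
    · rw [Measure.restrict_apply measurableSet_Iic]
      convert! ENNReal.zero_lt_top
      convert! measure_empty (μ := multiscaleRadius d μ κ)
      ext x
      simp only [mem_inter_iff, mem_Iic, mem_Ioc, mem_empty_iff_false, iff_false]
      rintro ⟨h1, h2, -⟩
      linarith
    · refine (Measure.restrict_apply_le _ _).trans_lt ?_
      unfold multiscaleRadius
      rw [Measure.add_apply, Measure.sum_apply _ measurableSet_Ioi,
        tsum_eq_sum (s := Finset.range n) fun i hi => ?_]
      · exact ENNReal.add_lt_top.2 ⟨measure_lt_top _ _,
          ENNReal.sum_lt_top.2 fun i _ => measure_lt_top _ _⟩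
      · refine rescaleRadius_scale_apply_eq_zero hκ i measurableSet_Ioi fun x hx hx0 hx1 => ?_
        have hni : n ≤ i := by simpa using hi
        have h1 : 1 < κ ^ n * x := by
          have hx' : κ⁻¹ ^ n < x := hx
          rwa [inv_pow, inv_lt_iff_one_lt_mul₀ (by positivity), mul_comm] at hx'
        have h2 : κ ^ n * x ≤ κ ^ i * x :=
          mul_le_mul_of_nonneg_right (pow_le_pow_right₀ hκ.le hni) hx0.le
        linarith
  · refine eq_univ_of_forall fun x => ?_
    rcases le_or_gt x 0 with hx | hx
    · exact mem_iUnion.2 ⟨0, Or.inl hx⟩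
    · obtain ⟨n, hn⟩ := exists_pow_lt_of_lt_one hx (inv_lt_one_of_one_lt₀ hκ)
      exact mem_iUnion.2 ⟨n, Or.inr hn⟩

/-- The truncated radius measure of the multiscale model, seen at scale `κ ^ j`, is dominated by the
radius measure truncated at `1`. -/
lemma radiusDominated_multiscaleRadius (hμ : μ (Iio 1) = 0) (hκ₀ : 1 < κ₀)
    (hyp : ScalingHyp d μ κ₀) (hκ : κ₀ ≤ κ) {j : ℕ} (hj : 1 ≤ j) :
    RadiusDominated (rescaleRadius d (κ ^ j) ((multiscaleRadius d μ κ).restrict (Ioc 0 (κ ^ j))))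
      ((multiscaleRadius d μ κ).restrict (Ioc 0 1)) := by
  have hκ1 : 1 < κ := by linarith
  have hκ0 : 0 < κ := by linarith
  let a : ℕ → Measure ℝ := fun i => rescaleRadius d (κ ^ (i + 1)) (μ.restrict (Icc 1 κ))
  have hsum : Measure.sum a
      = (∑ n ∈ Finset.range j, a n) + Measure.sum fun i => a (i + j) := by
    ext s hs
    rw [Measure.add_apply, Measure.finsetSum_apply, Measure.sum_apply _ hs, Measure.sum_apply _ hs]
    exact (ENNReal.summable.sum_add_tsum_nat_add' (k := j)).symm
  have hres : μ.restrict (Ioc 0 (κ ^ j)) = μ.restrict (Icc 1 (κ ^ j)) := by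
    refine Measure.restrict_congr_set ?_
    have h1 : ∀ᵐ x ∂μ, x ∉ Iio 1 := measure_eq_zero_iff_ae_notMem.1 hμ
    filter_upwards [h1] with x hx
    have hx1 : 1 ≤ x := not_lt.1 hx
    refine propext ⟨fun h => ⟨hx1, h.2⟩, fun h => ⟨by linarith, h.2⟩⟩
  rw [restrict_multiscaleRadius hκ1 le_rfl,
    restrict_multiscaleRadius hκ1 (one_le_pow₀ hκ1.le), rescaleRadius_add, rescaleRadius_sum, hres]
  have hshift : ∀ i, rescaleRadius d (κ ^ j)
      (rescaleRadius d (κ ^ (i + 1)) (μ.restrict (Icc 1 κ))) = a (i + j) := by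
    intro i
    rw [rescaleRadius_rescaleRadius d (by positivity), ← pow_add]
    simp only [a]
    congr 2
    ring
  simp_rw [hshift]
  change RadiusDominated _ (μ.restrict (Ioc 0 1) + Measure.sum a)
  rw [hsum]
  -- The part `μ|_{(0,1]}` (a possible atom at `1`) is left unmatched, the first `j` scales receive
  -- the large radii, and the later scales are matched identically.
  have h := (RadiusDominated.zero_left (μ.restrict (Ioc 0 1))).add
    ((radiusDominated_rescale_restrict hκ₀ hyp hκ hj).add
      (RadiusDominated.refl (Measure.sum fun i => a (i + j))))
  rwa [zero_add] at h

end

/-! ### Comparison of connection probabilities -/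

/-- The dilation by `s⁻¹` sends each ball of `S` into a concentric ball of `T`, so it carries an
occupied path of `S` to one of `T`. -/
lemma connEvent_of_rescale {d : ℕ} {s l : ℝ} (hs : 0 < s) {S T : Config (Euc d × ℝ)}
    (h : ∀ p ∈ S.points, ∃ q ∈ T.points, p.1 = s • q.1 ∧ p.2 ≤ s * q.2)
    (hS : S ∈ connEvent (Metric.closedBall 0 s) (Metric.sphere (0 : Euc d) (l * s))) :
    T ∈ connEvent (Metric.closedBall 0 1) (Metric.sphere (0 : Euc d) l) := by
  obtain ⟨x, hx, y, hy, hxy⟩ := hS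
  have hnorm : ∀ z : Euc d, ‖s⁻¹ • z‖ = s⁻¹ * ‖z‖ := fun z => by
    rw [norm_smul, Real.norm_of_nonneg (inv_nonneg.2 hs.le)]
  refine ⟨s⁻¹ • x, ?_, s⁻¹ • y, ?_, ?_⟩
  · rw [mem_closedBall_zero_iff] at hx ⊢
    rw [hnorm, inv_mul_le_iff₀ hs, mul_one]
    exact hx
  · rw [mem_sphere_zero_iff_norm] at hy ⊢
    rw [hnorm, hy, mul_comm l s, inv_mul_cancel_left₀ hs.ne']
  · have hcont : Continuous fun z : Euc d => s⁻¹ • z := by fun_prop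
    obtain ⟨γ, hγ⟩ := hxy
    have hjoin : JoinedIn ((fun z => s⁻¹ • z) '' occupied S) (s⁻¹ • x) (s⁻¹ • y) :=
      ⟨γ.map hcont, fun t => ⟨γ t, hγ t, rfl⟩⟩
    refine hjoin.mono ?_
    rintro _ ⟨z, hz, rfl⟩
    obtain ⟨p, hp, hzp⟩ := mem_iUnion₂.1 hz
    obtain ⟨q, hq, hpq, hr⟩ := h p hp
    refine mem_iUnion₂.2 ⟨q, hq, ?_⟩
    rw [mem_closedBall_iff_norm] at hzp ⊢
    rw [hpq] at hzp
    have : s⁻¹ • z - q.1 = s⁻¹ • (z - s • q.1) := by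
      rw [smul_sub, inv_smul_smul₀ hs.ne']
    rw [this, hnorm, inv_mul_le_iff₀ hs]
    exact hzp.trans hr

/-- If the radius measure `ν`, seen at scale `s`, is dominated by `ν'`, then connections at scale
`s` in the model of radius measure `ν` are at most as likely as connections at scale `1` in the
model of radius measure `ν'`. -/
lemma RadiusDominated.connEvent_le {d : ℕ} (hd : 1 ≤ d) {s l : ℝ} (hs : 0 < s) {ν ν' : Measure ℝ}
    [SigmaFinite ν] (h : RadiusDominated (_root_.rescaleRadius d s ν) ν') {lam : ℝ≥0}
    {P Q : Measure (Config (Euc d × ℝ))} (hP : IsBooleanLaw d lam ν P)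
    (hQ : IsBooleanLaw d lam ν' Q) :
    P (connEvent (Metric.closedBall 0 s) (Metric.sphere 0 (l * s)))
      ≤ Q (connEvent (Metric.closedBall 0 1) (Metric.sphere 0 l)) := by
  obtain ⟨γ, _, hγ, hγ'⟩ := h
  have : NeZero d := ⟨by omega⟩
  have : Nontrivial (Euc d) := inferInstance
  -- Lebesgue measure has no atoms in positive dimension, so neither intensity has, whatever the
  -- atoms of the radius measures.
  have hatom : ∀ (τ : Measure ℝ), SFinite τ → ∀ x : Euc d × ℝ,
      (lam • (volume : Measure (Euc d)).prod τ) {x} = 0 := by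
    rintro τ _ ⟨z, r⟩
    rw [← singleton_prod_singleton, Measure.smul_apply, Measure.prod_prod]
    simp
  have hsν' : SFinite ν' := hγ' ▸ inferInstance
  let f : Euc d × (ℝ × ℝ) → Euc d × ℝ := Prod.map (fun z => s • z) fun p => s * p.1
  let g : Euc d × (ℝ × ℝ) → Euc d × ℝ := Prod.map id Prod.snd
  have hf : Measurable f := by fun_prop
  have hg : Measurable g := by fun_prop
  have hle := RadiusDominated.measurableSet_le'
  have hmul : Measurable fun r : ℝ => s * r := by fun_prop
  have hdiv : Measurable fun r : ℝ => r / s := by fun_prop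
  -- The factor `s ^ d` in `𝒯_s` cancels the `s ^ (-d)` produced by dilating Lebesgue measure on the
  -- centres.
  have hfmap : ((lam • (volume : Measure (Euc d)).prod γ).restrict
      (univ ×ˢ {p | p.1 ≤ p.2})).map f = lam • (volume : Measure (Euc d)).prod ν := by
    have h1 : (γ.restrict {p | p.1 ≤ p.2}).map (fun p => s * p.1)
        = ENNReal.ofReal (s ^ d) • ν := by
      have h2 : (fun p : ℝ × ℝ => s * p.1) = (fun r => s * r) ∘ Prod.fst := rfl
      rw [h2, ← Measure.map_map hmul measurable_fst, hγ, _root_.rescaleRadius, Measure.map_smul,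
        Measure.map_map hmul hdiv]
      have h3 : (fun r => s * r) ∘ (fun r : ℝ => r / s) = id := by
        funext r
        simp [mul_div_cancel₀ _ hs.ne']
      rw [h3, Measure.map_id]
    rw [Measure.restrict_smul, Measure.map_smul, ← Measure.prod_restrict, Measure.restrict_univ,
      ← Measure.map_prod_map _ _ (by fun_prop) (by fun_prop), h1,
      Measure.map_addHaar_smul _ hs.ne', Measure.prod_smul_left, Measure.prod_smul_right, smul_smul,
      ← ENNReal.ofReal_mul (abs_nonneg _), finrank_euclideanSpace_fin,
      abs_of_pos (by positivity), inv_mul_cancel₀ (by positivity), ENNReal.ofReal_one, one_smul]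
  have hgmap : ((lam • (volume : Measure (Euc d)).prod γ).restrict univ).map g
      = lam • (volume : Measure (Euc d)).prod ν' := by
    rw [Measure.restrict_univ, Measure.map_smul,
      ← Measure.map_prod_map _ _ measurable_id measurable_snd, Measure.map_id, hγ']
  refine IsPoissonLaw.le_of_coupling (lam • (volume : Measure (Euc d)).prod γ) hf hg
    (MeasurableSet.univ.prod hle) MeasurableSet.univ hfmap hgmap (hatom ν inferInstance)
    (hatom ν' hsν') hP hQ fun ω hω => connEvent_of_rescale hs ?_ hω
  rintro _ ⟨i, ⟨hi, -, hi'⟩, rfl⟩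
  refine ⟨_, ⟨i, ⟨hi, mem_univ _⟩, rfl⟩, rfl, ?_⟩
  exact mul_le_mul_of_nonneg_left hi' hs.le

end

theorem proposition3 (d : ℕ) (hd : 2 ≤ d)
    (μ : Measure ℝ) [IsFiniteMeasure μ] (hμ_supp : μ (Iio 1) = 0)
    (hμ_moment : ∫⁻ t, ENNReal.ofReal (t ^ d) ∂μ < ∞)
    (κ₀ : ℝ) (hκ₀ : 1 < κ₀) (hyp : ScalingHyp d μ κ₀)
    (κ : ℝ) (hκ : κ₀ ≤ κ) (j : ℕ) (hj : 1 ≤ j) (l : ℝ) (hl : 1 < l) (lam : ℝ≥0)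
    (P Q : Measure (Config (Euc d × ℝ)))
    (hP : IsBooleanLaw d lam ((multiscaleRadius d μ κ).restrict (Ioc 0 (κ ^ j))) P)
    (hQ : IsBooleanLaw d lam ((multiscaleRadius d μ κ).restrict (Ioc 0 1)) Q) :
    P (connEvent (Metric.closedBall 0 (κ ^ j)) (Metric.sphere 0 (l * κ ^ j)))
      ≤ Q (connEvent (Metric.closedBall 0 1) (Metric.sphere 0 l)) := by
  have hκ1 : 1 < κ := hκ₀.trans_le hκ
  have := sigmaFinite_restrict_multiscaleRadius (d := d) (μ := μ) hκ1 (t := κ ^ j)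
  exact (radiusDominated_multiscaleRadius hμ_supp hκ₀ hyp hκ hj).connEvent_le (by omega)
    (by positivity) hP hQ
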